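/- Theorem (PAC sample complexity for $\varepsilon$-optimal efficiency). Setting. Let $(\mathcal S,\mathcal A,P,c,\gamma)$ be a discounted MDP with $n$ states, $m$ actions, transition probabilities $P_a(s'\mid s)$, costs $c_a(s)\in\mathbb R$, discount factor $\gamma\in(0,1)$ and initial distribution $\alpha$. For a randomized policy $\pi$ let $P^\pi(s,s')=\sum_a\pi_a(s)P_a(s'\mid s)$, $\mu^\pi_\alpha=(1-\gamma)\,\alpha\sum_{t\ge0}\gamma^t(P^\pi)^t$, and let $\xi^\pi_a(s)=\pi_a(s)\mu^\pi_\alpha(s)$ be the occupation measure. Let $\pi^1,\dots,\pi^d$ ($d\ge1$) be base policies, let $\Psi\in\mathbb R^{nm\times d}$ be the matrix with columns $\psi^i=\xi^{\pi^i}$ and rows $\Psi_a(s)$, let $\|\cdot\|$ be a norm on $\mathbb R^d$ with dual norm $\|\cdot\|_*$, let $\Theta_R=\{\theta:\|\theta\|\le R\}$, $\Theta_2=\{\theta:\theta^T\mathbf 1=1\}$, and $\|\Psi\|_{*,2}=\sup_{x\ne0}\|x^T\Psi\|_*/\|x\|_2$. Let $\theta^*$ be an optimal solution of the dual approximate linear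 program $$\min\{c^T\Psi\theta:\ \Psi\theta\succeq0,\ \theta\in\Theta_2\cap\Theta_R\},$$ put $\xi^*=\Psi\theta^*$, and suppose that $L(\theta,\lambda)=c^T\Psi\theta-\lambda^T\Psi\theta$ has a saddle point on $(\Theta_2\cap\Theta_R)\times\mathbb R^{nm}_+$. Assumptions. (A.1) For a fixed $\delta\in(0,1)$ the mixing time $\tau_{\rm mix}=\max_\pi\min\{t\ge1:\ \|(P^\pi)^t(s,\cdot)-\nu^\pi\|_{\rm TV}\le\delta\ \forall s\}$ is finite, where $\nu^\pi$ is the stationary distribution of $P^\pi$. (A.2) For every policy $\pi$ the chain $P^\pi$ is ergodic (irreducible and aperiodic), and there is $\kappa>0$ such that $\frac1{n\sqrt\kappa}\le\mu_\alpha^\pi(s)\le\frac{\sqrt\kappa}n$ for all $\pi$ and $s$. (A.3) The costs are accessed only through the samples drawn by the algorithm. Algorithm. Let $\phi$ be a Legendre function with domain $\Theta_R$ that is strongly convex with respect to $\|\cdot\|$ with some modulus $\sigma>0$, and let $\phi^*(y)=\sup_{x\in\Theta_R}\{\langle x,y\rangle-\phi(x)\}$. Let $\beta>0$, $G_\beta=\frac1{1-\gamma}\vee\beta$,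 $\eta_t=1/\sqrt{t+1}$, $\lambda_0=0$, and let $\theta_0\in\Theta_2$ lie in the interior of $\Theta_R$. In round $t=0,1,\dots,T-1$ draw, independently of the past, $i$ uniformly from $\{1,\dots,d\}$ and $(s_t,a_t)\sim\psi^i$, observe $c_{a_t}(s_t)$, and set $$g_t=\frac{(c_{a_t}(s_t)-\lambda_{t,a_t}(s_t))\Psi_{a_t}(s_t)}{\frac1d\sum_{i}\psi^i_{a_t}(s_t)},\qquad \tilde\theta_t=\nabla\phi^*(\nabla\phi(\theta_t)-\eta_tg_t),$$ $$z_t=\arg\min_{z\in\mathbb R}\{\phi^*(z\mathbf 1+\nabla\phi(\tilde\theta_t))-z\},\qquad \theta_{t+1}=\nabla\phi^*(z_t\mathbf 1+\nabla\phi(\tilde\theta_t)),$$ and let $\lambda_{t+1}$ be the Euclidean projection of $\lambda_t+\eta_t\nabla_\lambda L(\theta_t,\lambda_t)=\lambda_t-\eta_t\Psi\theta_t$ onto $\{\lambda\succeq0:\|\lambda\|_2\le G_\beta\}$. Let $\hat\theta_T=\sum_{t<T}\eta_t\theta_t/\sum_{t<T}\eta_t$. The output is the policy $\pi_a^{\hat\theta_T}(s)=[(\Psi\hat\theta_T)_a(s)]_+/\sum_{a'}[(\Psi\hat\theta_T)_{a'}(s)]_+$,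 uniform at states where the denominator vanishes. Let $\xi^{\hat\theta_T}$ be its occupation measure. Claim. If the parameter $\beta$ is sufficiently large and $$T=\Omega\!\left(\frac{\tau_{\rm mix}^4\,nm\,\|\Psi\|_{*,2}^4}{(1-\gamma)^4\varepsilon^4}\right)\qquad(\varepsilon\to0),$$ then for every $\rho\in(0,1)$ and all sufficiently small $\varepsilon$, with probability at least $1-\rho$, $$c^T\xi^{\hat\theta_T}\le c^T\xi^*+\varepsilon .$$ Precisely: there is $\beta_0>0$ such that for all $\beta\ge\beta_0$, $C>0$ and $\rho\in(0,1)$ there is $\varepsilon_0>0$ such that for all $\varepsilon\in(0,\varepsilon_0)$ and all integers $T\ge C\,\tau_{\rm mix}^4nm\|\Psi\|_{*,2}^4/((1-\gamma)^4\varepsilon^4)$ the inequality holds with probability at least $1-\rho$. -/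

import Mathlib

open Matrix Filter Topology MeasureTheory
open scoped BigOperators

namespace MixtureMDP

/-- A discounted Markov decision process with `n` states and `m` actions; `P s a s'` is the
probability of moving from `s` to `s'` under the action `a`, `c s a` is the cost, `γ` the discount
factor and `α` the initial distribution of the states. -/
structure MDP (n m : ℕ) where
  P : Fin n → Fin m → Fin n → ℝ
  P_mem : ∀ s a, P s a ∈ stdSimplex ℝ (Fin n)
  c : Fin n → Fin m → ℝ
  γ : ℝ
  γ_pos : 0 < γ
  γ_lt_one : γ < 1
  α : Fin n → ℝ
  α_mem : α ∈ stdSimplex ℝ (Fin n)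

/-- The set of (stationary) randomized policies; `π s a` is the probability of the action `a` in
the state `s`. -/
def policies (n m : ℕ) : Set (Fin n → Fin m → ℝ) :=
  {π | ∀ s, π s ∈ stdSimplex ℝ (Fin m)}

/-- Total variation distance of two distributions on a finite set. -/
noncomputable def tvDist {n : ℕ} (p q : Fin n → ℝ) : ℝ := (1 / 2) * ∑ s, |p s - q s|

namespace MDP

variable {n m : ℕ} (M : MDP n m)

/-- The transition matrix `P^π` of the Markov chain induced by the policy `π`. -/
def trans (π : Fin n → Fin m → ℝ) : Matrix (Fin n) (Fin n) ℝ :=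
  Matrix.of fun s s' => ∑ a, π s a * M.P s a s'

/-- The state measure `μ_α^π = (1 - γ) α ∑ₜ γ^t (P^π)^t`. -/
noncomputable def stateMeasure (π : Fin n → Fin m → ℝ) (s : Fin n) : ℝ :=
  (1 - M.γ) * ∑' t : ℕ, M.γ ^ t * (M.α ᵥ* (M.trans π ^ t)) s

/-- The occupation measure `ξ^π` on state-action pairs. -/
noncomputable def occ (π : Fin n → Fin m → ℝ) (p : Fin n × Fin m) : ℝ :=
  π p.1 p.2 * M.stateMeasure π p.1

/-- The value `cᵀ ξ` for a vector `ξ` indexed by state-action pairs. -/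
def cost (ξ : Fin n × Fin m → ℝ) : ℝ := ∑ p, M.c p.1 p.2 * ξ p

/-- After `t` steps the chain of `π` is, from every initial state, within total variation
distance `δ` of its stationary distribution. -/
def MixedAt (δ : ℝ) (π : Fin n → Fin m → ℝ) (t : ℕ) : Prop :=
  ∀ ν ∈ stdSimplex ℝ (Fin n), ν ᵥ* M.trans π = ν →
    ∀ s, tvDist ((M.trans π ^ t) s) ν ≤ δ

/-- Fast mixing at level `δ`: the mixing times of all policies are finite and bounded. -/
def FastMixing (δ : ℝ) : Prop :=
  ∃ τ : ℕ, ∀ π ∈ policies n m, ∃ t, 1 ≤ t ∧ t ≤ τ ∧ M.MixedAt δ π t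

/-- `τ_mix(δ) = max_π min {t ≥ 1 : the chain of π is δ-mixed at time t}`. -/
noncomputable def mixingTime (δ : ℝ) : ℕ :=
  ⨆ π : policies n m, sInf {t : ℕ | 1 ≤ t ∧ M.MixedAt δ π t}

/-- Uniformly bounded ergodicity: the chain of every policy is ergodic (irreducible and aperiodic,
i.e. its transition matrix is primitive), and the state measures of all policies are uniformly
comparable to the uniform distribution. -/
def UniformlyErgodic : Prop :=
  (∀ π ∈ policies n m, (M.trans π).IsPrimitive) ∧
  ∃ κ : ℝ, 0 < κ ∧ ∀ π ∈ policies n m, ∀ s,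
    1 / (n * Real.sqrt κ) ≤ M.stateMeasure π s ∧ M.stateMeasure π s ≤ Real.sqrt κ / n

theorem trans_mem {π : Fin n → Fin m → ℝ} (hπ : π ∈ policies n m) :
    M.trans π ∈ rowStochastic ℝ (Fin n) := by
  rw [mem_rowStochastic_iff_sum]
  simp only [trans, Matrix.of_apply]
  refine ⟨fun s s' => Finset.sum_nonneg fun a _ =>
    mul_nonneg ((hπ s).1 a) ((M.P_mem s a).1 s'), fun s => ?_⟩
  rw [Finset.sum_comm]
  simp_rw [← Finset.mul_sum, (M.P_mem s _).2, mul_one]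
  exact (hπ s).2

theorem vecMul_pow_nonneg {π : Fin n → Fin m → ℝ} (hπ : π ∈ policies n m) (t : ℕ) (s : Fin n) :
    0 ≤ (M.α ᵥ* (M.trans π ^ t)) s :=
  nonneg_vecMul_of_mem_rowStochastic (pow_mem (M.trans_mem hπ) t) (fun i => M.α_mem.1 i) s

theorem vecMul_pow_sum {π : Fin n → Fin m → ℝ} (hπ : π ∈ policies n m) (t : ℕ) :
    ∑ s, (M.α ᵥ* (M.trans π ^ t)) s = 1 := by
  have h := vecMul_dotProduct_one_eq_one_rowStochastic (x := M.α)
    (pow_mem (M.trans_mem hπ) t) (by simpa [dotProduct] using M.α_mem.2)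
  simpa [dotProduct] using h

theorem summable_stateMeasure {π : Fin n → Fin m → ℝ} (hπ : π ∈ policies n m) (s : Fin n) :
    Summable fun t : ℕ => M.γ ^ t * (M.α ᵥ* (M.trans π ^ t)) s := by
  refine Summable.of_nonneg_of_le
    (fun t => mul_nonneg (pow_nonneg M.γ_pos.le t) (M.vecMul_pow_nonneg hπ t s))
    (fun t => ?_) (summable_geometric_of_lt_one M.γ_pos.le M.γ_lt_one)
  refine mul_le_of_le_one_right (pow_nonneg M.γ_pos.le t) ?_
  rw [← M.vecMul_pow_sum hπ t]
  exact Finset.single_le_sum (fun i _ => M.vecMul_pow_nonneg hπ t i) (Finset.mem_univ s)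

theorem stateMeasure_nonneg {π : Fin n → Fin m → ℝ} (hπ : π ∈ policies n m) (s : Fin n) :
    0 ≤ M.stateMeasure π s :=
  mul_nonneg (sub_nonneg.2 M.γ_lt_one.le) (tsum_nonneg fun t =>
    mul_nonneg (pow_nonneg M.γ_pos.le t) (M.vecMul_pow_nonneg hπ t s))

theorem stateMeasure_sum {π : Fin n → Fin m → ℝ} (hπ : π ∈ policies n m) :
    ∑ s, M.stateMeasure π s = 1 := by
  simp only [stateMeasure]
  rw [← Finset.mul_sum, ← Summable.tsum_finsetSum fun s _ => M.summable_stateMeasure hπ s]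
  simp_rw [← Finset.mul_sum, M.vecMul_pow_sum hπ, mul_one]
  rw [tsum_geometric_of_lt_one M.γ_pos.le M.γ_lt_one]
  exact mul_inv_cancel₀ (sub_pos.2 M.γ_lt_one).ne'

theorem occ_nonneg {π : Fin n → Fin m → ℝ} (hπ : π ∈ policies n m) (p : Fin n × Fin m) :
    0 ≤ M.occ π p :=
  mul_nonneg ((hπ p.1).1 p.2) (M.stateMeasure_nonneg hπ p.1)

theorem occ_sum {π : Fin n → Fin m → ℝ} (hπ : π ∈ policies n m) : ∑ p, M.occ π p = 1 := by
  rw [Fintype.sum_prod_type]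
  simp only [occ]
  simp_rw [← Finset.sum_mul, (hπ _).2, one_mul]
  exact M.stateMeasure_sum hπ

end MDP

/-- The data of the dual approximate linear program: an MDP, `d` base policies, and the norm and
the radius that determine the size of the policy class. -/
structure DualALP (n m d : ℕ) where
  mdp : MDP n m
  base : Fin d → Fin n → Fin m → ℝ
  base_mem : ∀ i, base i ∈ policies n m
  nrm : Seminorm ℝ (EuclideanSpace ℝ (Fin d))
  nrm_definite : ∀ θ, nrm θ = 0 → θ = 0
  R : ℝ

/-- The Fenchel conjugate `φ*(y) = sup_{x ∈ C} (⟨x, y⟩ - φ(x))` of a function with domain `C`. -/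
noncomputable def conjugate {d : ℕ} (C : Set (EuclideanSpace ℝ (Fin d)))
    (φ : EuclideanSpace ℝ (Fin d) → ℝ) (y : EuclideanSpace ℝ (Fin d)) : ℝ :=
  sSup ((fun x => inner ℝ x y - φ x) '' C)

/-- Legendre functions with domain `C` (the values of `φ` outside `C` are irrelevant). -/
structure IsLegendre {d : ℕ} (C : Set (EuclideanSpace ℝ (Fin d)))
    (φ : EuclideanSpace ℝ (Fin d) → ℝ) : Prop where
  nonempty : C.Nonempty
  convex_relint : Convex ℝ (intrinsicInterior ℝ C)
  strictConvexOn : StrictConvexOn ℝ C φ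
  contDiffOn : ContDiffOn ℝ 1 φ (interior C)
  gradient_tendsto : ∀ (x : ℕ → EuclideanSpace ℝ (Fin d)) (b : EuclideanSpace ℝ (Fin d)),
    (∀ k, x k ∈ interior C) → b ∈ frontier C → Tendsto x atTop (𝓝 b) →
      Tendsto (fun k => ‖gradient φ (x k)‖) atTop atTop

/-- The all-ones vector. -/
def onesVec (d : ℕ) : EuclideanSpace ℝ (Fin d) := WithLp.toLp 2 fun _ => 1

namespace DualALP

variable {n m d : ℕ} (A : DualALP n m d)

/-- The feature matrix `Ψ`, whose columns are the occupation measures of the base policies. -/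
noncomputable def feat : Matrix (Fin n × Fin m) (Fin d) ℝ :=
  Matrix.of fun p i => A.mdp.occ (A.base i) p

/-- The vector `Ψ θ`. -/
noncomputable def mix (θ : EuclideanSpace ℝ (Fin d)) : Fin n × Fin m → ℝ := A.feat *ᵥ θ.ofLp

/-- The policy class `Θ_R`, the closed ball of radius `R` of the given norm. -/
def ball : Set (EuclideanSpace ℝ (Fin d)) := {θ | A.nrm θ ≤ A.R}

/-- The hyperplane section `Θ_2 ∩ Θ_R`, with `Θ_2 = {θ : θᵀ 1 = 1}`. -/
def section2 : Set (EuclideanSpace ℝ (Fin d)) := {θ | ∑ i, θ i = 1 ∧ θ ∈ A.ball}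

/-- The feasible set of the dual ALP: `Ψ θ ≥ 0`, `θᵀ 1 = 1`, `‖θ‖ ≤ R`. -/
def feasible : Set (EuclideanSpace ℝ (Fin d)) := {θ ∈ A.section2 | ∀ p, 0 ≤ A.mix θ p}

/-- `θ` is an optimal solution of the dual ALP. -/
def IsOptimal (θ : EuclideanSpace ℝ (Fin d)) : Prop :=
  θ ∈ A.feasible ∧ ∀ θ' ∈ A.feasible, A.mdp.cost (A.mix θ) ≤ A.mdp.cost (A.mix θ')

/-- The Lagrangian `L(θ, lam) = cᵀ Ψ θ - lamᵀ Ψ θ`. -/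
noncomputable def lagrangian (θ : EuclideanSpace ℝ (Fin d))
    (lam : EuclideanSpace ℝ (Fin n × Fin m)) : ℝ :=
  A.mdp.cost (A.mix θ) - ∑ p, lam p * A.mix θ p

/-- Saddle points of the Lagrangian over `(Θ_2 ∩ Θ_R) × ℝ₊^{nm}`. -/
def IsSaddlePoint (θ : EuclideanSpace ℝ (Fin d))
    (lam : EuclideanSpace ℝ (Fin n × Fin m)) : Prop :=
  θ ∈ A.section2 ∧ (∀ p, 0 ≤ lam p) ∧
  (∀ lam' : EuclideanSpace ℝ (Fin n × Fin m), (∀ p, 0 ≤ lam' p) →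
    A.lagrangian θ lam' ≤ A.lagrangian θ lam) ∧
  (∀ θ' ∈ A.section2, A.lagrangian θ lam ≤ A.lagrangian θ' lam)

/-- The dual norm `‖z‖_* = sup_{‖x‖ ≤ 1} ⟨z, x⟩`. -/
noncomputable def dualNrm (z : EuclideanSpace ℝ (Fin d)) : ℝ :=
  sSup ((fun x => inner ℝ z x) '' {x | A.nrm x ≤ 1})

/-- The subordinate norm `‖Ψ‖_{*,2} = sup_{x ≠ 0} ‖xᵀ Ψ‖_* / ‖x‖₂`. -/
noncomputable def subordNorm : ℝ :=
  sSup ((fun x : EuclideanSpace ℝ (Fin n × Fin m) =>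
    A.dualNrm (WithLp.toLp 2 (x.ofLp ᵥ* A.feat)) / ‖x‖) '' {x | x ≠ 0})

/-- The randomized policy of `θ`: in each state, the normalized positive part of `Ψ θ`, and the
uniform distribution where the positive part vanishes. -/
noncomputable def policyOf (θ : EuclideanSpace ℝ (Fin d)) (s : Fin n) (a : Fin m) : ℝ :=
  if ∑ a', max (A.mix θ (s, a')) 0 = 0 then 1 / m
  else max (A.mix θ (s, a)) 0 / ∑ a', max (A.mix θ (s, a')) 0

/-- The law of one query: a base policy `i` is drawn uniformly, then a state-action pair is drawn
from the occupation measure of the base policy `i`. -/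
noncomputable def queryLaw [NeZero d] : PMF (Fin d × (Fin n × Fin m)) :=
  PMF.ofFintype (fun q => ENNReal.ofReal ((1 / d) * A.feat q.2 q.1)) (by
    rw [← ENNReal.ofReal_sum_of_nonneg fun q _ => mul_nonneg (by positivity)
      (A.mdp.occ_nonneg (A.base_mem q.1) q.2), Fintype.sum_prod_type]
    have hd : (d : ℝ) ≠ 0 := Nat.cast_ne_zero.2 (NeZero.ne d)
    simp_rw [feat, Matrix.of_apply, ← Finset.mul_sum, A.mdp.occ_sum (A.base_mem _)]
    simp [hd])

/-- The stochastic gradient of the Lagrangian in `θ`, computed from the sampled pair `p` and the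
incurred cost `c p`. -/
noncomputable def stochGrad (lam : EuclideanSpace ℝ (Fin n × Fin m)) (p : Fin n × Fin m) :
    EuclideanSpace ℝ (Fin d) :=
  WithLp.toLp 2 fun j =>
    (A.mdp.c p.1 p.2 * A.feat p j - lam p * A.feat p j) / ((1 / d) * ∑ i, A.feat p i)

/-- The radius `G_β = max (1 / (1 - γ)) β`. -/
noncomputable def multiplierBound (β : ℝ) : ℝ := max (1 / (1 - A.mdp.γ)) β

/-- Learning rate. -/
noncomputable def stepSize (t : ℕ) : ℝ := 1 / Real.sqrt (t + 1)

/-- Primal update: the mirror step `θ' = ∇φ*(∇φ(θ) - η g)`, the minimizer `z` of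
`J(z) = φ*(z 1 + ∇φ(θ')) - z`, and the new iterate `∇φ*(z 1 + ∇φ(θ'))`. -/
noncomputable def primalStep (φ : EuclideanSpace ℝ (Fin d) → ℝ) (η : ℝ)
    (θ g : EuclideanSpace ℝ (Fin d)) : EuclideanSpace ℝ (Fin d) :=
  let θ' := gradient (conjugate A.ball φ) (gradient φ θ - η • g)
  let z : ℝ := Classical.epsilon fun z : ℝ =>
    IsMinOn (fun z : ℝ => conjugate A.ball φ (z • onesVec d + gradient φ θ') - z) Set.univ z
  gradient (conjugate A.ball φ) (z • onesVec d + gradient φ θ')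

/-- The Euclidean projection onto `{x : 0 ≤ x, ‖x‖₂ ≤ G}`: positive part, then radial scaling. -/
noncomputable def projMultiplier (G : ℝ) (x : EuclideanSpace ℝ (Fin n × Fin m)) :
    EuclideanSpace ℝ (Fin n × Fin m) :=
  let y : EuclideanSpace ℝ (Fin n × Fin m) := WithLp.toLp 2 fun p => max (x p) 0
  (G / max G ‖y‖) • y

/-- Dual update: projected gradient ascent in the multipliers, with `∇_lam L(θ, lam) = -Ψ θ`. -/
noncomputable def dualStep (β η : ℝ) (θ : EuclideanSpace ℝ (Fin d))
    (lam : EuclideanSpace ℝ (Fin n × Fin m)) : EuclideanSpace ℝ (Fin n × Fin m) :=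
  projMultiplier (A.multiplierBound β) (lam + η • WithLp.toLp 2 fun p => -A.mix θ p)

/-- The iterates `(θ_t, lam_t)` of the algorithm along the sequence `ω` of query results. -/
noncomputable def iterates (φ : EuclideanSpace ℝ (Fin d) → ℝ) (β : ℝ)
    (θ₀ : EuclideanSpace ℝ (Fin d)) (ω : ℕ → Fin d × (Fin n × Fin m)) :
    ℕ → EuclideanSpace ℝ (Fin d) × EuclideanSpace ℝ (Fin n × Fin m)
  | 0 => (θ₀, 0)
  | t + 1 =>
    let x := iterates φ β θ₀ ω t
    (A.primalStep φ (stepSize t) x.1 (A.stochGrad x.2 (ω t).2),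
      A.dualStep β (stepSize t) x.1 x.2)

/-- The running average `θ̂_T` after `T` rounds. -/
noncomputable def average (φ : EuclideanSpace ℝ (Fin d) → ℝ) (β : ℝ)
    (θ₀ : EuclideanSpace ℝ (Fin d)) (T : ℕ) (ω : ℕ → Fin d × (Fin n × Fin m)) :
    EuclideanSpace ℝ (Fin d) :=
  (∑ t ∈ Finset.range T, stepSize t)⁻¹ •
    ∑ t ∈ Finset.range T, stepSize t • (A.iterates φ β θ₀ ω t).1

/-- The law of an i.i.d. sequence of queries. -/
noncomputable def queryMeasure [NeZero d] : Measure (ℕ → Fin d × (Fin n × Fin m)) :=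
  Measure.infinitePi fun _ => A.queryLaw.toMeasure

end DualALP

end MixtureMDP

/-! The algorithm is stochastic mirror descent in `θ` against projected gradient ascent in the
multipliers. With steps `1/√(t+1)` its averaged duality gap is of order `log T / √T`, with constants
independent of `T` and `ε`. At `T ≥ κ/ε⁴` one has `√T ≥ √κ/ε²`, so for small `ε` the gap is far
below `ε`. Of `τ_mix`, `‖Ψ‖_{*,2}` and the other factors in the sample size only their positivity
matters, since `ε₀` may depend on the instance.

Three ingredients carry the argument.

Regret. `∇φ` maps the interior of `Θ_R` onto the whole dual space, because its image is closed
(gradients blow up at the frontier) and open (strong convexity), and `∇φ*` inverts it. Hence a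
primal step is a Bregman step up to a multiple of the all-ones vector, which is invisible on the
hyperplane `Σ θ_i = 1`. Telescoping the primal and dual steps (`sum_lagrangian_gap_le`) leaves a
constant, a multiple of `Σ η_t²`, and the gradient noise.

Noise. Importance weighting makes the sampled gradient unbiased, so the noise terms are bounded
martingale differences. They are orthogonal, the second moment of their sum is `O(Σ η_t²)`, and
Chebyshev's inequality gives probability `1 - ρ`.

From gap to policy. Let `lam` be a saddle multiplier. If the gap bound holds against every
multiplier of norm at most `G ≥ ‖lam‖ + 1`, exact penalization bounds the negative part of `Ψθ` by
the gap (`cost_policyOf_le_of_gap`). Since `Ψθ` satisfies the discounted flow equations, clipping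
its negative part perturbs them slightly, and their `ℓ¹` stability puts the occupation measure of
the output policy close to `Ψθ` (`sum_abs_occ_policyOf_sub_mix_le`). -/

namespace MixtureMDP

/-! ### Comparison of the given norm with the Euclidean norm. -/

section FiniteDimensionalSeminorm

variable {d : ℕ} (p : Seminorm ℝ (EuclideanSpace ℝ (Fin d)))

theorem seminorm_continuous : Continuous p := by
  have h : ConvexOn ℝ Set.univ p := p.convexOn
  exact continuousOn_univ.1 (h.continuousOn isOpen_univ)

theorem exists_pos_mul_norm_le_seminorm (hp : ∀ x, p x = 0 → x = 0) :
    ∃ c : ℝ, 0 < c ∧ ∀ x, c * ‖x‖ ≤ p x := by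
  rcases (Metric.sphere (0 : EuclideanSpace ℝ (Fin d)) 1).eq_empty_or_nonempty with he | hne
  -- The sphere is empty only in dimension zero, where any constant works.
  · refine ⟨1, one_pos, fun x => ?_⟩
    have hx : x = 0 := by
      by_contra hx
      have : (‖x‖⁻¹ : ℝ) • x ∈ Metric.sphere (0 : EuclideanSpace ℝ (Fin d)) 1 := by
        simp [norm_smul, norm_ne_zero_iff.2 hx]
      simp [he] at this
    simp [hx]
  · obtain ⟨z, hz, hmin⟩ := (isCompact_sphere _ _).exists_isMinOn hne
      (seminorm_continuous p).continuousOn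
    have hz0 : z ≠ 0 := by
      rintro rfl
      simp at hz
    refine ⟨p z, lt_of_le_of_ne (apply_nonneg p z) fun h => hz0 (hp z h.symm), fun x => ?_⟩
    rcases eq_or_ne x 0 with rfl | hx
    · simp
    have hx' : 0 < ‖x‖ := norm_pos_iff.2 hx
    have h : p z ≤ p ((‖x‖⁻¹ : ℝ) • x) := hmin (by simp [norm_smul, hx'.ne'])
    rw [map_smul_eq_mul, norm_inv, norm_norm, inv_mul_eq_div, le_div_iff₀ hx'] at h
    exact h

theorem isCompact_seminorm_le (hp : ∀ x, p x = 0 → x = 0) (R : ℝ) :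
    IsCompact {x | p x ≤ R} := by
  obtain ⟨c, hc, h⟩ := exists_pos_mul_norm_le_seminorm p hp
  refine Metric.isCompact_of_isClosed_isBounded
    (isClosed_le (seminorm_continuous p) continuous_const) ?_
  refine (Metric.isBounded_closedBall (x := (0 : EuclideanSpace ℝ (Fin d)))
    (r := R / c)).subset fun x hx => ?_
  rw [mem_closedBall_zero_iff, le_div_iff₀ hc, mul_comm]
  exact (h x).trans hx

end FiniteDimensionalSeminorm

/-! ### Legendre functions: the gradient map and its inverse, the gradient of the conjugate. -/

section MirrorMap

variable {d : ℕ} {C : Set (EuclideanSpace ℝ (Fin d))} {φ : EuclideanSpace ℝ (Fin d) → ℝ} {σ : ℝ}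

/-- Strong convexity of `φ` on `C` in terms of the Euclidean norm and the gradients of `φ` at the
interior points. -/
def StronglyConvexGradient (C : Set (EuclideanSpace ℝ (Fin d)))
    (φ : EuclideanSpace ℝ (Fin d) → ℝ) (σ : ℝ) : Prop :=
  ∀ x ∈ interior C, ∀ y ∈ C,
    φ x + inner ℝ (gradient φ x) (y - x) + σ / 2 * ‖y - x‖ ^ 2 ≤ φ y

theorem IsLegendre.differentiableAt (hφ : IsLegendre C φ) {x : EuclideanSpace ℝ (Fin d)}
    (hx : x ∈ interior C) : DifferentiableAt ℝ φ x :=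
  (hφ.contDiffOn.differentiableOn one_ne_zero).differentiableAt (isOpen_interior.mem_nhds hx)

theorem IsLegendre.continuousOn_gradient (hφ : IsLegendre C φ) :
    ContinuousOn (gradient φ) (interior C) :=
  (InnerProductSpace.toDual ℝ (EuclideanSpace ℝ (Fin d))).symm.continuous.comp_continuousOn
    (hφ.contDiffOn.continuousOn_fderiv_of_isOpen isOpen_interior le_rfl)

/-- If gradients converge, their base points subconverge in `C` by compactness. The limit cannot lie
on the frontier, where the gradients would be unbounded. -/
theorem IsLegendre.isClosed_image_gradient (hφ : IsLegendre C φ) (hC : IsCompact C) :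
    IsClosed (gradient φ '' interior C) := by
  refine IsSeqClosed.isClosed fun y b hy hb => ?_
  choose x hx hxy using hy
  obtain ⟨a, ha, k, hk, hlim⟩ := hC.tendsto_subseq fun j => interior_subset (hx j)
  have hyk : Tendsto (fun j => gradient φ (x (k j))) atTop (𝓝 b) := by
    simpa only [hxy, Function.comp_def] using hb.comp hk.tendsto_atTop
  by_cases hai : a ∈ interior C
  · refine ⟨a, hai, tendsto_nhds_unique ?_ hyk⟩
    exact ((hφ.continuousOn_gradient.continuousAt
      (isOpen_interior.mem_nhds hai)).tendsto.comp hlim)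
  · have hfr : a ∈ frontier C := by
      rw [hC.isClosed.frontier_eq]
      exact ⟨ha, hai⟩
    exact absurd (hφ.gradient_tendsto _ a (fun j => hx (k j)) hfr hlim)
      (not_tendsto_atTop_of_tendsto_nhds hyk.norm)

/-- For `y` near `∇φ(x₀)`, a minimizer of `φ - ⟨y, ·⟩` over a small ball around `x₀` is a critical
point as soon as it avoids the sphere. It does when `‖y - ∇φ(x₀)‖ < σr/2`: at distance `r` the
quadratic growth of `φ` beats the linear tilt. -/
theorem IsLegendre.isOpen_image_gradient (hφ : IsLegendre C φ) (hσ : 0 < σ)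
    (hs : StronglyConvexGradient C φ σ) : IsOpen (gradient φ '' interior C) := by
  rw [Metric.isOpen_iff]
  rintro _ ⟨x₀, hx₀, rfl⟩
  obtain ⟨r, hr, hball⟩ := Metric.nhds_basis_closedBall.mem_iff.1 (isOpen_interior.mem_nhds hx₀)
  refine ⟨σ / 2 * r, by positivity, fun y hy => ?_⟩
  have hdiff : ∀ x ∈ interior C,
      HasGradientAt (fun x => φ x - inner ℝ y x) (gradient φ x - y) x := fun x hx => by
    have h1 := (hφ.differentiableAt hx).hasGradientAt.hasFDerivAt
    have h2 : HasFDerivAt (fun x => inner ℝ y x) (InnerProductSpace.toDual ℝ _ y) x :=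
      (InnerProductSpace.toDual ℝ _ y).hasFDerivAt
    rw [hasGradientAt_iff_hasFDerivAt, map_sub]
    exact h1.sub h2
  obtain ⟨x₁, hx₁, hmin⟩ := (isCompact_closedBall x₀ r).exists_isMinOn
    ⟨x₀, Metric.mem_closedBall_self hr.le⟩
    (f := fun x => φ x - inner ℝ y x) fun x hx =>
      (hdiff x (hball hx)).continuousAt.continuousWithinAt
  have h1 : φ x₁ - inner ℝ y x₁ ≤ φ x₀ - inner ℝ y x₀ := hmin (Metric.mem_closedBall_self hr.le)
  have h2 := hs x₀ hx₀ x₁ (interior_subset (hball hx₁))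
  have h3 : inner ℝ (y - gradient φ x₀) (x₁ - x₀) ≤ ‖y - gradient φ x₀‖ * ‖x₁ - x₀‖ :=
    real_inner_le_norm _ _
  have h4 : inner ℝ (y - gradient φ x₀) (x₁ - x₀) =
      inner ℝ y x₁ - inner ℝ y x₀ - inner ℝ (gradient φ x₀) (x₁ - x₀) := by
    rw [inner_sub_left, inner_sub_right y]
  have h5 : ‖y - gradient φ x₀‖ < σ / 2 * r := by rwa [mem_ball_iff_norm] at hy
  have h6 : ‖x₁ - x₀‖ < r := by
    by_contra! hcon
    have : ‖y - gradient φ x₀‖ * ‖x₁ - x₀‖ < σ / 2 * ‖x₁ - x₀‖ ^ 2 := by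
      rw [pow_two, ← mul_assoc]
      refine mul_lt_mul_of_pos_right (h5.trans_le ?_) (hr.trans_le hcon)
      gcongr
    linarith
  have hloc : IsLocalMin (fun x => φ x - inner ℝ y x) x₁ :=
    hmin.isLocalMin (Metric.closedBall_mem_nhds_of_mem (by rwa [mem_ball_iff_norm]))
  refine ⟨x₁, hball hx₁, ?_⟩
  have h0 := hloc.hasFDerivAt_eq_zero (hdiff x₁ (hball hx₁)).hasFDerivAt
  exact sub_eq_zero.1 ((InnerProductSpace.toDual ℝ _).map_eq_zero_iff.1 h0)

/-- The gradient of a strongly convex Legendre function on a compact set is onto. -/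
theorem IsLegendre.exists_gradient_eq (hφ : IsLegendre C φ) (hC : IsCompact C) (hσ : 0 < σ)
    (hs : StronglyConvexGradient C φ σ) (hne : (interior C).Nonempty)
    (y : EuclideanSpace ℝ (Fin d)) : ∃ x ∈ interior C, gradient φ x = y := by
  have h : gradient φ '' interior C = Set.univ :=
    IsClopen.eq_univ ⟨hφ.isClosed_image_gradient hC, hφ.isOpen_image_gradient hσ hs⟩
      (hne.image _)
  have hy : y ∈ gradient φ '' interior C := h ▸ Set.mem_univ y
  exact hy

theorem StronglyConvexGradient.isGreatest (hσ : 0 < σ) (hs : StronglyConvexGradient C φ σ)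
    {x : EuclideanSpace ℝ (Fin d)} (hx : x ∈ interior C) :
    IsGreatest ((fun z => inner ℝ z (gradient φ x) - φ z) '' C)
      (inner ℝ x (gradient φ x) - φ x) := by
  refine ⟨⟨x, interior_subset hx, rfl⟩, ?_⟩
  rintro _ ⟨z, hz, rfl⟩
  have h := hs x hx z hz
  rw [inner_sub_right, real_inner_comm z, real_inner_comm x] at h
  have : 0 ≤ σ / 2 * ‖z - x‖ ^ 2 := by positivity
  simp only
  linarith

theorem StronglyConvexGradient.conjugate_gradient (hσ : 0 < σ) (hs : StronglyConvexGradient C φ σ)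
    {x : EuclideanSpace ℝ (Fin d)} (hx : x ∈ interior C) :
    conjugate C φ (gradient φ x) = inner ℝ x (gradient φ x) - φ x :=
  (hs.isGreatest hσ hx).csSup_eq

theorem StronglyConvexGradient.monotone (hs : StronglyConvexGradient C φ σ)
    {x y : EuclideanSpace ℝ (Fin d)} (hx : x ∈ interior C) (hy : y ∈ interior C) :
    σ * ‖x - y‖ ^ 2 ≤ inner ℝ (gradient φ x - gradient φ y) (x - y) := by
  have h1 := hs x hx y (interior_subset hy)
  have h2 := hs y hy x (interior_subset hx)
  rw [norm_sub_rev] at h1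
  have h3 : inner ℝ (gradient φ x) (y - x) = -inner ℝ (gradient φ x) (x - y) := by
    rw [← inner_neg_right, neg_sub]
  rw [inner_sub_left]
  linarith

/-- The conjugate lies above its tangents. -/
theorem StronglyConvexGradient.le_conjugate (hσ : 0 < σ) (hs : StronglyConvexGradient C φ σ)
    {x z : EuclideanSpace ℝ (Fin d)} (hx : x ∈ interior C) (hz : z ∈ C) :
    inner ℝ z (gradient φ x) - φ z ≤ conjugate C φ (gradient φ x) := by
  rw [hs.conjugate_gradient hσ hx]
  exact (hs.isGreatest hσ hx).2 ⟨z, hz, rfl⟩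

/-- Every dual point is some `∇φ(z)`, so the Fenchel inequalities at `x` and `z` trap the
first-order remainder between `0` and `⟨∇φ(z) - ∇φ(x), z - x⟩`. Strong monotonicity bounds this by
`σ⁻¹ ‖∇φ(z) - ∇φ(x)‖²`. -/
theorem IsLegendre.hasGradientAt_conjugate (hφ : IsLegendre C φ) (hC : IsCompact C) (hσ : 0 < σ)
    (hs : StronglyConvexGradient C φ σ) {x : EuclideanSpace ℝ (Fin d)} (hx : x ∈ interior C) :
    HasGradientAt (conjugate C φ) x (gradient φ x) := by
  rw [hasGradientAt_iff_isLittleO]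
  have hbound : ∀ y, ‖conjugate C φ y - conjugate C φ (gradient φ x) -
      inner ℝ x (y - gradient φ x)‖ ≤ σ⁻¹ * ‖y - gradient φ x‖ ^ 2 := fun y => by
    obtain ⟨z, hz, rfl⟩ := hφ.exists_gradient_eq hC hσ hs ⟨x, hx⟩ y
    have h1 := hs.le_conjugate hσ hz (interior_subset hx)
    have h2 := hs.le_conjugate hσ hx (interior_subset hz)
    have h3 := hs.conjugate_gradient hσ hx
    have h4 := hs.conjugate_gradient hσ hz
    have h5 := hs.monotone hz hx
    have h6 : inner ℝ (gradient φ z - gradient φ x) (z - x) ≤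
      ‖gradient φ z - gradient φ x‖ * ‖z - x‖ := real_inner_le_norm _ _
    have h7 : ‖z - x‖ ≤ σ⁻¹ * ‖gradient φ z - gradient φ x‖ := by
      rcases (norm_nonneg (z - x)).eq_or_lt' with h | h
      · rw [h]; positivity
      · rw [inv_mul_eq_div, le_div_iff₀ hσ]
        have : σ * ‖z - x‖ * ‖z - x‖ ≤ ‖gradient φ z - gradient φ x‖ * ‖z - x‖ := by
          nlinarith
        linarith [le_of_mul_le_mul_right this h]
    have h8 : ‖gradient φ z - gradient φ x‖ * ‖z - x‖ ≤
        σ⁻¹ * ‖gradient φ z - gradient φ x‖ ^ 2 := by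
      have := mul_le_mul_of_nonneg_left h7 (norm_nonneg (gradient φ z - gradient φ x))
      linarith
    have h9 : inner ℝ (gradient φ z - gradient φ x) (z - x) =
        inner ℝ z (gradient φ z) - inner ℝ z (gradient φ x) -
        (inner ℝ x (gradient φ z) - inner ℝ x (gradient φ x)) := by
      rw [inner_sub_left, inner_sub_right, inner_sub_right, real_inner_comm z, real_inner_comm x,
        real_inner_comm z, real_inner_comm x]
      ring
    rw [inner_sub_right, Real.norm_eq_abs, abs_le]
    constructor <;> linarith
  refine Asymptotics.IsBigO.trans_isLittleO (g := fun y => ‖y - gradient φ x‖ ^ 2)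
    (Asymptotics.IsBigO.of_bound σ⁻¹ (Eventually.of_forall fun y => ?_)) ?_
  · simpa using hbound y
  · refine Asymptotics.IsLittleO.of_norm_right ?_
    have h : (fun y => ‖y - gradient φ x‖ ^ 2) =
        (fun t : ℝ => t ^ 2) ∘ fun y => ‖y - gradient φ x‖ := rfl
    have hlim : Tendsto (fun y => ‖y - gradient φ x‖) (𝓝 (gradient φ x)) (𝓝 0) := by
      have hc : Continuous fun y : EuclideanSpace ℝ (Fin d) => ‖y - gradient φ x‖ := by fun_prop
      simpa using hc.tendsto (gradient φ x)
    exact (Asymptotics.isLittleO_pow_id (𝕜 := ℝ) (n := 2) one_lt_two).comp_tendsto hlim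

theorem IsLegendre.gradient_conjugate (hφ : IsLegendre C φ) (hC : IsCompact C) (hσ : 0 < σ)
    (hs : StronglyConvexGradient C φ σ) {x : EuclideanSpace ℝ (Fin d)} (hx : x ∈ interior C) :
    gradient (conjugate C φ) (gradient φ x) = x :=
  (hφ.hasGradientAt_conjugate hC hσ hs hx).gradient

theorem inner_onesVec (x : EuclideanSpace ℝ (Fin d)) : inner ℝ x (onesVec d) = ∑ i, x i := by
  simp [onesVec, PiLp.inner_apply]

/-- The function minimized in the second half of the mirror step has derivative `∑ i, x i - 1`,
where `x` is the image of the dual point under the gradient of the conjugate. -/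
theorem IsLegendre.hasDerivAt_conjugate_line (hφ : IsLegendre C φ) (hC : IsCompact C) (hσ : 0 < σ)
    (hs : StronglyConvexGradient C φ σ) {x w : EuclideanSpace ℝ (Fin d)} {z : ℝ}
    (hx : x ∈ interior C) (hxz : gradient φ x = z • onesVec d + w) :
    HasDerivAt (fun z : ℝ => conjugate C φ (z • onesVec d + w) - z) (∑ i, x i - 1) z := by
  have h1 := (hφ.hasGradientAt_conjugate hC hσ hs hx).hasFDerivAt
  rw [hxz] at h1
  have h2 : HasDerivAt (fun z : ℝ => z • onesVec d + w) (onesVec d) z := by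
    simpa using ((hasDerivAt_id z).smul_const (onesVec d)).add_const w
  have h3 := h1.comp_hasDerivAt z h2
  rw [InnerProductSpace.toDual_apply_apply, inner_onesVec] at h3
  exact h3.sub (hasDerivAt_id z)

/-- Coercivity comes from interiority of `x₀`: the points `x₀ ± (ε/2) 1` lie in `C`, and testing the
conjugate against them gives affine minorants of slopes `±(ε/2) d`. -/
theorem IsLegendre.exists_isMinOn_conjugate_line (hφ : IsLegendre C φ) (hC : IsCompact C)
    (hσ : 0 < σ) (hs : StronglyConvexGradient C φ σ) [NeZero d]
    {x₀ : EuclideanSpace ℝ (Fin d)} (hx₀ : x₀ ∈ interior C) (hsum : ∑ i, x₀ i = 1)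
    (w : EuclideanSpace ℝ (Fin d)) :
    ∃ z : ℝ, IsMinOn (fun z : ℝ => conjugate C φ (z • onesVec d + w) - z) Set.univ z := by
  have hcont : Continuous fun z : ℝ => conjugate C φ (z • onesVec d + w) - z := by
    refine continuous_iff_continuousAt.2 fun z => ?_
    obtain ⟨x, hx, hxz⟩ := hφ.exists_gradient_eq hC hσ hs ⟨x₀, hx₀⟩ (z • onesVec d + w)
    exact (hφ.hasDerivAt_conjugate_line hC hσ hs hx hxz).continuousAt
  have hnear : ∀ᶠ r : ℝ in 𝓝 0, x₀ + r • onesVec d ∈ interior C := by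
    have hc : Continuous fun r : ℝ => x₀ + r • onesVec d := by fun_prop
    exact hc.continuousAt.eventually_mem (isOpen_interior.mem_nhds (by simpa using hx₀))
  obtain ⟨ε, hε, hr⟩ := Metric.eventually_nhds_iff.1 hnear
  have hmem : ∀ r : ℝ, |r| < ε → x₀ + r • onesVec d ∈ C := fun r h =>
    interior_subset (hr (by simpa using h))
  have hlow : ∀ r : ℝ, |r| < ε → ∃ b : ℝ, ∀ z : ℝ,
      (r * d) * z + b ≤ conjugate C φ (z • onesVec d + w) - z := fun r h => by
    refine ⟨inner ℝ (x₀ + r • onesVec d) w - φ (x₀ + r • onesVec d), fun z => ?_⟩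
    obtain ⟨x, hx, hxz⟩ := hφ.exists_gradient_eq hC hσ hs ⟨x₀, hx₀⟩ (z • onesVec d + w)
    have h1 := hs.le_conjugate hσ hx (hmem r h)
    rw [hxz, inner_add_right, real_inner_smul_right, inner_onesVec] at h1
    have h2 : ∑ i, (x₀ + r • onesVec d) i = 1 + r * d := by
      simp [onesVec, Finset.sum_add_distrib, hsum, mul_comm]
    rw [h2] at h1
    linarith
  have hd : (0 : ℝ) < d := Nat.cast_pos.2 (NeZero.pos d)
  obtain ⟨b₁, hb₁⟩ := hlow (ε / 2) (by rw [abs_of_pos (by positivity)]; linarith)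
  obtain ⟨b₂, hb₂⟩ := hlow (-(ε / 2)) (by rw [abs_neg, abs_of_pos (by positivity)]; linarith)
  have hpos : 0 < ε / 2 * d := by positivity
  have htop : Tendsto (fun z : ℝ => conjugate C φ (z • onesVec d + w) - z)
      (cocompact ℝ) atTop := by
    rw [cocompact_eq_atBot_atTop]
    refine Tendsto.sup ?_ ?_
    · refine tendsto_atTop_mono hb₂ (tendsto_atTop_add_const_right _ _ ?_)
      exact tendsto_id.const_mul_atBot_of_neg (by linarith)
    · refine tendsto_atTop_mono hb₁ (tendsto_atTop_add_const_right _ _ ?_)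
      exact tendsto_id.const_mul_atTop hpos
  obtain ⟨z, hz⟩ := hcont.exists_forall_le htop
  exact ⟨z, fun y _ => hz y⟩

end MirrorMap

/-! ### The primal step of the algorithm. -/

namespace DualALP

variable {n m d : ℕ} (A : DualALP n m d)

theorem isCompact_ball : IsCompact A.ball := isCompact_seminorm_le A.nrm A.nrm_definite A.R

/-- The primal step stays in the interior of the ball and in the hyperplane, and is a mirror step
up to a multiple of the all-ones vector. -/
theorem primalStep_spec [NeZero d] {φ : EuclideanSpace ℝ (Fin d) → ℝ} {σ : ℝ}
    (hφ : IsLegendre A.ball φ) (hσ : 0 < σ) (hs : StronglyConvexGradient A.ball φ σ)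
    {θ : EuclideanSpace ℝ (Fin d)} (hθ : θ ∈ interior A.ball) (hsum : ∑ i, θ i = 1)
    (η : ℝ) (g : EuclideanSpace ℝ (Fin d)) :
    A.primalStep φ η θ g ∈ interior A.ball ∧ ∑ i, A.primalStep φ η θ g i = 1 ∧
      ∃ z : ℝ, gradient φ (A.primalStep φ η θ g) =
        z • onesVec d + (gradient φ θ - η • g) := by
  obtain ⟨x, hx, hxy⟩ := hφ.exists_gradient_eq A.isCompact_ball hσ hs ⟨θ, hθ⟩
    (gradient φ θ - η • g)
  have hgx : gradient (conjugate A.ball φ) (gradient φ θ - η • g) = x := by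
    rw [← hxy, hφ.gradient_conjugate A.isCompact_ball hσ hs hx]
  have hz := Classical.epsilon_spec (hφ.exists_isMinOn_conjugate_line A.isCompact_ball hσ hs hθ
    hsum (gradient φ x))
  set z : ℝ := Classical.epsilon fun z : ℝ =>
    IsMinOn (fun z : ℝ => conjugate A.ball φ (z • onesVec d + gradient φ x) - z) Set.univ z with hzdef
  have hstep : A.primalStep φ η θ g =
      gradient (conjugate A.ball φ) (z • onesVec d + gradient φ x) := by
    simp only [primalStep, hgx, hzdef]
  obtain ⟨y, hy, hyz⟩ := hφ.exists_gradient_eq A.isCompact_ball hσ hs ⟨θ, hθ⟩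
    (z • onesVec d + gradient φ x)
  have hstep' : A.primalStep φ η θ g = y := by
    rw [hstep, ← hyz, hφ.gradient_conjugate A.isCompact_ball hσ hs hy]
  -- Stationarity in `z` is exactly the constraint that the coordinates of the new iterate sum to
  -- one.
  have h0 := (hz.isLocalMin univ_mem).hasDerivAt_eq_zero
    (hφ.hasDerivAt_conjugate_line A.isCompact_ball hσ hs hy hyz)
  rw [hstep']
  exact ⟨hy, by linarith, z, by rw [hyz, hxy]⟩

end DualALP

/-! ### Martingale differences along an i.i.d. sequence with finitely many values. -/

section MartingaleDifferences

/-- A function of the first `t` coordinates factors through the restriction to them. -/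
theorem exists_factor_of_dependsOn {Q : Type*} [Nonempty Q] {β : Type*} {t : ℕ} {f : (ℕ → Q) → β}
    (hf : DependsOn f (Set.Iio t)) :
    ∃ g : (Finset.range t → Q) → β, f = fun ω => g fun i => ω i := by
  classical
  refine ⟨fun r => f fun i => if h : i ∈ Finset.range t then r ⟨i, h⟩ else Classical.arbitrary Q,
    funext fun ω => hf fun i hi => ?_⟩
  have hi' : i < t := hi
  simp [hi']

variable {Q : Type*} [Fintype Q] [Nonempty Q] [MeasurableSpace Q] [MeasurableSingletonClass Q]

/-- Such a function factors through a finite space, so measurability and boundedness are automatic.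
This covers the iterates although they involve `Classical.epsilon`. -/
theorem integrable_of_dependsOn (μ : Measure (ℕ → Q)) [IsFiniteMeasure μ] {t : ℕ}
    {f : (ℕ → Q) → ℝ} (hf : DependsOn f (Set.Iio t)) : Integrable f μ := by
  obtain ⟨g, rfl⟩ := exists_factor_of_dependsOn hf
  have hm : Measurable fun (ω : ℕ → Q) (i : Finset.range t) => ω i := by fun_prop
  exact (Integrable.of_finite (μ := μ.map fun (ω : ℕ → Q) (i : Finset.range t) => ω i)
    (f := g)).comp_measurable hm

variable (p : PMF Q)

theorem integral_mul_eval_of_dependsOn {t : ℕ} {h : (ℕ → Q) → ℝ}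
    (hh : DependsOn h (Set.Iio t)) (k : Q → ℝ) :
    ∫ ω, h ω * k (ω t) ∂(Measure.infinitePi fun _ : ℕ => p.toMeasure) =
      (∫ ω, h ω ∂(Measure.infinitePi fun _ : ℕ => p.toMeasure)) * ∑ q, (p q).toReal * k q := by
  set μ := Measure.infinitePi fun _ : ℕ => p.toMeasure with hμ
  have hint := integrable_of_dependsOn μ hh
  obtain ⟨g, rfl⟩ := exists_factor_of_dependsOn hh
  have hindep : ProbabilityTheory.iIndepFun (fun (i : ℕ) (ω : ℕ → Q) => ω i) μ :=
    ProbabilityTheory.iIndepFun_infinitePi (X := fun _ q => q) (fun _ => measurable_id)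
  have h1 := hindep.indepFun_finset (Finset.range t) {t} (by simp) (fun i => by fun_prop)
  have h2 : ProbabilityTheory.IndepFun (fun ω : ℕ → Q => g fun i : Finset.range t => ω i)
      (fun ω => k (ω t)) μ :=
    h1.comp (φ := g) (ψ := fun r : ({t} : Finset ℕ) → Q => k (r ⟨t, by simp⟩))
      (measurable_of_finite _) (measurable_of_finite _)
  have hk : Measurable k := measurable_of_finite k
  have hkt : ∫ ω, k (ω t) ∂μ = ∑ q, (p q).toReal * k q := by
    have h3 := (measurePreserving_eval_infinitePi (fun _ : ℕ => p.toMeasure) t)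
    rw [show (∫ ω, k (ω t) ∂μ) = ∫ q, k q ∂(μ.map (Function.eval t)) from
      (integral_map h3.measurable.aemeasurable hk.aestronglyMeasurable).symm, h3.map_eq,
      PMF.integral_eq_sum]
    simp [smul_eq_mul]
  rw [← hkt]
  refine h2.integral_fun_mul_eq_mul_integral hint.aestronglyMeasurable ?_
  exact (hk.comp (measurable_pi_apply t)).aestronglyMeasurable

/-- Orthogonality of a martingale difference to the past. -/
theorem integral_mul_martingaleDifference {t : ℕ} {h : (ℕ → Q) → ℝ} {F : (ℕ → Q) → Q → ℝ}
    (hh : DependsOn h (Set.Iio t)) (hF : DependsOn F (Set.Iio t))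
    (hmean : ∀ ω, ∑ q, (p q).toReal * F ω q = 0) :
    ∫ ω, h ω * F ω (ω t) ∂(Measure.infinitePi fun _ : ℕ => p.toMeasure) = 0 := by
  classical
  set μ := Measure.infinitePi fun _ : ℕ => p.toMeasure with hμ
  have hq : ∀ q, DependsOn (fun ω => h ω * F ω q) (Set.Iio t) := fun q x y hxy => by
    simp only [hh hxy, hF hxy]
  -- Splitting by the value of the `t`-th query separates a factor depending on the past from one
  -- depending on `ω t`; independence then applies termwise.
  have h1 : ∀ ω : ℕ → Q, h ω * F ω (ω t) = ∑ q, h ω * F ω q * if ω t = q then 1 else 0 := by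
    simp
  have h2 : ∀ q, ∫ ω, h ω * F ω q * (if ω t = q then (1 : ℝ) else 0) ∂μ =
      ∫ ω, (p q).toReal * (h ω * F ω q) ∂μ := fun q => by
    rw [integral_mul_eval_of_dependsOn p (hq q) fun q' => if q' = q then 1 else 0,
      integral_const_mul]
    simp [mul_comm, hμ]
  simp_rw [h1]
  rw [integral_finsetSum, Finset.sum_congr rfl fun q _ => h2 q, ← integral_finsetSum]
  · rw [← integral_zero (ℕ → Q) ℝ (μ := μ)]
    congr 1
    funext ω
    have := hmean ω
    calc ∑ q, (p q).toReal * (h ω * F ω q) = h ω * ∑ q, (p q).toReal * F ω q := by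
          rw [Finset.mul_sum]
          exact Finset.sum_congr rfl fun q _ => by ring
      _ = 0 := by rw [this, mul_zero]
  · exact fun q _ => (integrable_of_dependsOn μ (hq q)).const_mul _
  · intro q _
    refine integrable_of_dependsOn μ (t := t + 1) fun x y hxy => ?_
    have h3 : ∀ i ∈ Set.Iio t, x i = y i := fun i hi => hxy i (Nat.lt_succ_of_lt hi)
    simp only [hh h3, hF h3, hxy t (Nat.lt_succ_self t)]

/-- The second moment of a sum of bounded martingale differences. -/
theorem integral_sq_sum_martingaleDifference_le {F : ℕ → (ℕ → Q) → Q → ℝ} {b : ℕ → ℝ}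
    (hF : ∀ t, DependsOn (F t) (Set.Iio t))
    (hmean : ∀ t ω, ∑ q, (p q).toReal * F t ω q = 0) (hb : ∀ t ω q, |F t ω q| ≤ b t) (T : ℕ) :
    ∫ ω, (∑ t ∈ Finset.range T, F t ω (ω t)) ^ 2
      ∂(Measure.infinitePi fun _ : ℕ => p.toMeasure) ≤ ∑ t ∈ Finset.range T, b t ^ 2 := by
  set μ := Measure.infinitePi fun _ : ℕ => p.toMeasure with hμ
  have hlast : ∀ t, DependsOn (fun ω => F t ω (ω t)) (Set.Iio (t + 1)) := fun t x y hxy => by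
    have h3 : ∀ i ∈ Set.Iio t, x i = y i := fun i hi => hxy i (Nat.lt_succ_of_lt hi)
    simp only [hF t h3, hxy t (Nat.lt_succ_self t)]
  have hsum : ∀ T, DependsOn (fun ω => ∑ t ∈ Finset.range T, F t ω (ω t)) (Set.Iio T) :=
    fun T x y hxy => Finset.sum_congr rfl fun t ht =>
      hlast t fun i hi => hxy i
        (Set.mem_Iio.2 (lt_of_lt_of_le (Set.mem_Iio.1 hi) (Finset.mem_range.1 ht)))
  have hcomp : ∀ {k : ℕ} {f : (ℕ → Q) → ℝ} (g : ℝ → ℝ), DependsOn f (Set.Iio k) →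
      Integrable (fun ω => g (f ω)) μ := fun g hf =>
    integrable_of_dependsOn μ fun x y hxy => congrArg g (hf hxy)
  induction T with
  | zero => simp
  | succ T ih =>
    -- The cross term of the expanded square vanishes.
    have h1 := integral_mul_martingaleDifference p (hsum T) (hF T) (hmean T)
    have hcross : Integrable (fun ω => (∑ t ∈ Finset.range T, F t ω (ω t)) * F T ω (ω T)) μ :=
      integrable_of_dependsOn μ (t := T + 1) fun x y hxy => by
        have h3 : ∀ i ∈ Set.Iio T, x i = y i := fun i hi => hxy i (Nat.lt_succ_of_lt hi)
        exact congrArg₂ (· * ·) (hsum T h3) (hlast T hxy)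
    have h2 : ∫ ω, (F T ω (ω T)) ^ 2 ∂μ ≤ b T ^ 2 := by
      calc ∫ ω, (F T ω (ω T)) ^ 2 ∂μ ≤ ∫ _, b T ^ 2 ∂μ :=
            integral_mono (hcomp (· ^ 2) (hlast T)) (integrable_const _) fun ω =>
              sq_le_sq' (abs_le.1 (hb T ω _)).1 (abs_le.1 (hb T ω _)).2
        _ = b T ^ 2 := by simp
    rw [Finset.sum_range_succ]
    simp_rw [Finset.sum_range_succ, add_sq, mul_assoc]
    rw [integral_add, integral_add, integral_const_mul, h1]
    · linarith
    · exact hcomp (· ^ 2) (hsum T)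
    · exact hcross.const_mul 2
    · exact (hcomp (· ^ 2) (hsum T)).add (hcross.const_mul 2)
    · exact hcomp (· ^ 2) (hlast T)

/-- Chebyshev's inequality for a sum of bounded martingale differences. -/
theorem one_sub_le_measureReal_sum_martingaleDifference_lt {F : ℕ → (ℕ → Q) → Q → ℝ} {b : ℕ → ℝ}
    (hF : ∀ t, DependsOn (F t) (Set.Iio t))
    (hmean : ∀ t ω, ∑ q, (p q).toReal * F t ω q = 0) (hb : ∀ t ω q, |F t ω q| ≤ b t) (T : ℕ)
    {ρ s : ℝ} (hs : 0 < s) (hρ : ∑ t ∈ Finset.range T, b t ^ 2 ≤ ρ * s ^ 2) :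
    1 - ρ ≤ (Measure.infinitePi fun _ : ℕ => p.toMeasure).real
      {ω | ∑ t ∈ Finset.range T, F t ω (ω t) < s} := by
  set μ := Measure.infinitePi fun _ : ℕ => p.toMeasure with hμ
  have hsq : DependsOn (fun ω => (∑ t ∈ Finset.range T, F t ω (ω t)) ^ 2) (Set.Iio T) :=
    fun x y hxy => by
      refine congrArg (· ^ 2) (Finset.sum_congr rfl fun t ht => ?_)
      have ht' := Finset.mem_range.1 ht
      simp only [hF t fun i hi => hxy i (lt_trans hi ht'), hxy t ht']
  have h1 := mul_meas_ge_le_integral_of_nonneg (μ := μ)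
    (f := fun ω => (∑ t ∈ Finset.range T, F t ω (ω t)) ^ 2)
    (Eventually.of_forall fun ω => sq_nonneg _) (integrable_of_dependsOn μ hsq) (s ^ 2)
  have h2 := integral_sq_sum_martingaleDifference_le p hF hmean hb T
  have h3 : μ.real {ω | s ^ 2 ≤ (∑ t ∈ Finset.range T, F t ω (ω t)) ^ 2} ≤ ρ := by
    have h4 : s ^ 2 * μ.real {ω | s ^ 2 ≤ (∑ t ∈ Finset.range T, F t ω (ω t)) ^ 2} ≤ s ^ 2 * ρ := by
      linarith
    exact le_of_mul_le_mul_left h4 (by positivity)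
  have h5 : (1 : ℝ) ≤ μ.real {ω | ∑ t ∈ Finset.range T, F t ω (ω t) < s} +
      μ.real {ω | s ^ 2 ≤ (∑ t ∈ Finset.range T, F t ω (ω t)) ^ 2} := by
    refine le_trans ?_ (measureReal_union_le _ _)
    rw [← probReal_univ (μ := μ)]
    refine measureReal_mono fun ω _ => ?_
    by_cases hω : ∑ t ∈ Finset.range T, F t ω (ω t) < s
    · exact Or.inl hω
    · exact Or.inr (pow_le_pow_left₀ hs.le (not_lt.1 hω) 2)
  linarith

end MartingaleDifferences

/-- The Bregman divergence of `φ`. -/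
noncomputable def bregman {d : ℕ} (φ : EuclideanSpace ℝ (Fin d) → ℝ)
    (u x : EuclideanSpace ℝ (Fin d)) : ℝ :=
  φ u - φ x - inner ℝ (gradient φ x) (u - x)

/-- The multipliers admitted by the algorithm. -/
def multiplierSet (n m : ℕ) (G : ℝ) : Set (EuclideanSpace ℝ (Fin n × Fin m)) :=
  {lam | (∀ p, 0 ≤ lam p) ∧ ‖lam‖ ≤ G}

/-- With `r = G/‖y‖ ≤ 1`, Cauchy–Schwarz gives `⟨y, l⟩ ≤ r‖y‖²`, and the squared distances then
differ by at least `(1 - r)²‖y‖²`. -/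
theorem norm_ball_scaling_sub_le {E : Type*} [NormedAddCommGroup E] [InnerProductSpace ℝ E]
    {G : ℝ} (hG : 0 < G) (y : E) {l : E} (hl : ‖l‖ ≤ G) :
    ‖(G / max G ‖y‖) • y - l‖ ≤ ‖y - l‖ := by
  rcases le_total ‖y‖ G with h | h
  · rw [max_eq_left h, div_self hG.ne', one_smul]
  · rw [max_eq_right h]
    have hy : 0 < ‖y‖ := hG.trans_le h
    set r := G / ‖y‖ with hr
    have hr0 : 0 ≤ r := by positivity
    have hr1 : r ≤ 1 := (div_le_one hy).2 h
    have hry : r * ‖y‖ = G := div_mul_cancel₀ _ hy.ne'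
    refine le_of_sq_le_sq ?_ (norm_nonneg _)
    rw [@norm_sub_sq_real, @norm_sub_sq_real, norm_smul, real_inner_smul_left, Real.norm_of_nonneg hr0]
    have hin : inner ℝ y l ≤ ‖y‖ * ‖l‖ := real_inner_le_norm y l
    have h1 : inner ℝ y l ≤ ‖y‖ * (r * ‖y‖) :=
      hin.trans (by rw [hry]; gcongr)
    have h2 := mul_le_mul_of_nonneg_left h1 (sub_nonneg.2 hr1)
    nlinarith [mul_nonneg (sub_nonneg.2 hr1) (mul_nonneg (sub_nonneg.2 hr1) (sq_nonneg ‖y‖))]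

/-- The only metric property of the projection that the regret bound needs. Clipping and radial
scaling each bring the point no farther from `l`. -/
theorem norm_projMultiplier_sub_le {n m : ℕ} {G : ℝ} (hG : 0 < G)
    (x : EuclideanSpace ℝ (Fin n × Fin m)) {l : EuclideanSpace ℝ (Fin n × Fin m)}
    (hl : l ∈ multiplierSet n m G) :
    ‖DualALP.projMultiplier G x - l‖ ≤ ‖x - l‖ := by
  refine (norm_ball_scaling_sub_le hG _ hl.2).trans ?_
  rw [EuclideanSpace.norm_eq, EuclideanSpace.norm_eq]
  refine Real.sqrt_le_sqrt (Finset.sum_le_sum fun p _ => ?_)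
  simp only [PiLp.sub_apply, Real.norm_eq_abs, sq_abs]
  have hp := hl.1 p
  rcases le_total (x p) 0 with h | h
  · rw [max_eq_right h]; nlinarith
  · rw [max_eq_left h]

theorem projMultiplier_mem {n m : ℕ} {G : ℝ} (hG : 0 < G)
    (x : EuclideanSpace ℝ (Fin n × Fin m)) :
    DualALP.projMultiplier G x ∈ multiplierSet n m G := by
  have hmax : 0 < max G ‖(WithLp.toLp 2 fun p => max (x p) 0 :
    EuclideanSpace ℝ (Fin n × Fin m))‖ := lt_max_of_lt_left hG
  refine ⟨fun p => ?_, ?_⟩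
  · simp only [DualALP.projMultiplier, PiLp.smul_apply, smul_eq_mul]
    positivity
  · simp only [DualALP.projMultiplier]
    rw [norm_smul, Real.norm_of_nonneg (by positivity), div_mul_eq_mul_div, div_le_iff₀ hmax]
    gcongr
    exact le_max_right _ _

/-! ### Regret of the primal-dual iteration. -/

namespace DualALP

variable {n m d : ℕ} (A : DualALP n m d)

/-- `Ψ θ` as a Euclidean vector. -/
noncomputable def mixVec (θ : EuclideanSpace ℝ (Fin d)) : EuclideanSpace ℝ (Fin n × Fin m) :=
  WithLp.toLp 2 (A.mix θ)

/-- The gradient of the Lagrangian in `θ`. -/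
noncomputable def lagrangianGrad (lam : EuclideanSpace ℝ (Fin n × Fin m)) :
    EuclideanSpace ℝ (Fin d) :=
  WithLp.toLp 2 fun j => ∑ p, (A.mdp.c p.1 p.2 - lam p) * A.feat p j

theorem inner_lagrangianGrad (θ : EuclideanSpace ℝ (Fin d))
    (lam : EuclideanSpace ℝ (Fin n × Fin m)) :
    inner ℝ (A.lagrangianGrad lam) θ = A.lagrangian θ lam := by
  simp only [lagrangianGrad, lagrangian, MDP.cost, mix, PiLp.inner_apply, Matrix.mulVec, dotProduct,
    RCLike.inner_apply, conj_trivial, ← Finset.sum_sub_distrib, ← sub_mul, Finset.mul_sum]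
  rw [Finset.sum_comm]
  exact Finset.sum_congr rfl fun p _ => Finset.sum_congr rfl fun j _ => by ring

theorem lagrangian_eq_sub_inner (θ : EuclideanSpace ℝ (Fin d))
    (lam : EuclideanSpace ℝ (Fin n × Fin m)) :
    A.lagrangian θ lam = A.mdp.cost (A.mix θ) - inner ℝ (A.mixVec θ) lam := by
  simp [lagrangian, mixVec, PiLp.inner_apply]

/-- The denominator is the marginal probability of the sampled pair, so it cancels in the mean. -/
theorem mean_stochGrad [NeZero d] (lam : EuclideanSpace ℝ (Fin n × Fin m)) :
    ∑ q, (A.queryLaw q).toReal • A.stochGrad lam q.2 = A.lagrangianGrad lam := by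
  have hnn : ∀ p i, 0 ≤ A.feat p i := fun p i => A.mdp.occ_nonneg (A.base_mem i) p
  have hd : (0 : ℝ) < d := Nat.cast_pos.2 (NeZero.pos d)
  have hq : ∀ q : Fin d × (Fin n × Fin m),
      (A.queryLaw q).toReal = 1 / d * A.feat q.2 q.1 := fun q => by
    rw [queryLaw, PMF.ofFintype_apply, ENNReal.toReal_ofReal]
    exact mul_nonneg (by positivity) (hnn _ _)
  ext j
  simp only [hq, lagrangianGrad, stochGrad, WithLp.ofLp_sum, WithLp.ofLp_smul, Finset.sum_apply,
    Pi.smul_apply, smul_eq_mul]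
  rw [Fintype.sum_prod_type_right]
  refine Finset.sum_congr rfl fun p _ => ?_
  dsimp only
  rw [← Finset.sum_mul, ← Finset.mul_sum, ← sub_mul]
  -- A pair of probability zero has a zero row in `Ψ`, so it contributes nothing to either side.
  by_cases h : ∑ i, A.feat p i = 0
  · have : A.feat p j = 0 := (Finset.sum_eq_zero_iff_of_nonneg fun i _ => hnn p i).1 h j
      (Finset.mem_univ j)
    simp [this]
  · field_simp

theorem multiplierBound_pos (β : ℝ) : 0 < A.multiplierBound β :=
  lt_max_of_lt_left (one_div_pos.2 (sub_pos.2 A.mdp.γ_lt_one))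

theorem dualStep_mem {β : ℝ} (η : ℝ) (θ : EuclideanSpace ℝ (Fin d))
    (lam : EuclideanSpace ℝ (Fin n × Fin m)) :
    A.dualStep β η θ lam ∈ multiplierSet n m (A.multiplierBound β) :=
  projMultiplier_mem (A.multiplierBound_pos β) _

theorem dualStep_regret {β η : ℝ} (θ : EuclideanSpace ℝ (Fin d))
    (lam : EuclideanSpace ℝ (Fin n × Fin m)) {l : EuclideanSpace ℝ (Fin n × Fin m)}
    (hl : l ∈ multiplierSet n m (A.multiplierBound β)) :
    η * (A.lagrangian θ l - A.lagrangian θ lam) ≤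
      ‖lam - l‖ ^ 2 / 2 - ‖A.dualStep β η θ lam - l‖ ^ 2 / 2 + η ^ 2 * ‖A.mixVec θ‖ ^ 2 / 2 := by
  have hneg : (WithLp.toLp 2 fun p => -A.mix θ p : EuclideanSpace ℝ (Fin n × Fin m)) =
      -A.mixVec θ := rfl
  have h1 := norm_projMultiplier_sub_le (A.multiplierBound_pos β) (lam + η • -A.mixVec θ) hl
  have h2 : ‖A.dualStep β η θ lam - l‖ ^ 2 ≤ ‖lam + η • -A.mixVec θ - l‖ ^ 2 := by
    rw [dualStep, hneg]
    gcongr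
  have h3 : lam + η • -A.mixVec θ - l = (lam - l) - η • A.mixVec θ := by
    rw [smul_neg]; abel
  rw [h3, norm_sub_sq_real (lam - l), norm_smul, mul_pow, Real.norm_eq_abs, sq_abs,
    real_inner_smul_right, real_inner_comm, inner_sub_right] at h2
  rw [lagrangian_eq_sub_inner, lagrangian_eq_sub_inner]
  linarith

/-- The three-point inequality of mirror descent. The multiple of the all-ones vector drops out
because `u` and the new iterate have the same coordinate sum; strong convexity pays for the
displacement from `θ`. -/
theorem primalStep_regret [NeZero d] {φ : EuclideanSpace ℝ (Fin d) → ℝ} {σ : ℝ}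
    (hφ : IsLegendre A.ball φ) (hσ : 0 < σ) (hs : StronglyConvexGradient A.ball φ σ)
    {θ u : EuclideanSpace ℝ (Fin d)} (hθ : θ ∈ interior A.ball) (hsum : ∑ i, θ i = 1)
    (hu : ∑ i, u i = 1) (η : ℝ) (g : EuclideanSpace ℝ (Fin d)) :
    η * inner ℝ g (θ - u) ≤ bregman φ u θ - bregman φ u (A.primalStep φ η θ g) +
      η ^ 2 * ‖g‖ ^ 2 / (2 * σ) := by
  obtain ⟨hx, hxsum, z, hz⟩ := A.primalStep_spec hφ hσ hs hθ hsum η g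
  set x := A.primalStep φ η θ g
  have h1 := hs θ hθ x (interior_subset hx)
  have h2 : inner ℝ (onesVec d) (u - x) = 0 := by
    rw [real_inner_comm, inner_onesVec]
    simp [Finset.sum_sub_distrib, hu, hxsum]
  have h3 : inner ℝ (gradient φ x) (u - x) =
      inner ℝ (gradient φ θ) (u - x) - η * inner ℝ g (u - x) := by
    rw [hz, inner_add_left, real_inner_smul_left, h2, inner_sub_left, real_inner_smul_left]
    ring
  have h4 : η * inner ℝ g (θ - x) ≤ σ / 2 * ‖x - θ‖ ^ 2 + η ^ 2 * ‖g‖ ^ 2 / (2 * σ) := by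
    have h5 : η * inner ℝ g (θ - x) ≤ |η| * ‖g‖ * ‖x - θ‖ := by
      rw [norm_sub_rev, mul_assoc]
      refine (le_abs_self _).trans ?_
      rw [abs_mul]
      gcongr
      exact abs_real_inner_le_norm _ _
    -- Young's inequality, with the defect written as a square.
    have h6 : σ / 2 * ‖x - θ‖ ^ 2 + η ^ 2 * ‖g‖ ^ 2 / (2 * σ) - |η| * ‖g‖ * ‖x - θ‖ =
        (σ * ‖x - θ‖ - |η| * ‖g‖) ^ 2 / (2 * σ) := by
      rw [← sq_abs η]
      field_simp
      ring
    have : 0 ≤ (σ * ‖x - θ‖ - |η| * ‖g‖) ^ 2 / (2 * σ) := by positivity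
    linarith
  have h5 : inner ℝ g (θ - u) = inner ℝ g (θ - x) - inner ℝ g (u - x) := by
    rw [← inner_sub_right]; congr 1; abel
  have h6 : inner ℝ (gradient φ θ) (u - θ) =
      inner ℝ (gradient φ θ) (u - x) + inner ℝ (gradient φ θ) (x - θ) := by
    rw [← inner_add_right]; congr 1; abel
  simp only [bregman]
  rw [h3, h5, h6]
  linarith

theorem iterates_fst_mem [NeZero d] {φ : EuclideanSpace ℝ (Fin d) → ℝ} {σ : ℝ}
    (hφ : IsLegendre A.ball φ) (hσ : 0 < σ) (hs : StronglyConvexGradient A.ball φ σ)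
    {θ₀ : EuclideanSpace ℝ (Fin d)} (hθ₀ : θ₀ ∈ interior A.ball) (hsum : ∑ i, θ₀ i = 1)
    (β : ℝ) (ω : ℕ → Fin d × (Fin n × Fin m)) (t : ℕ) :
    (A.iterates φ β θ₀ ω t).1 ∈ interior A.ball ∧ ∑ i, (A.iterates φ β θ₀ ω t).1 i = 1 := by
  induction t with
  | zero => exact ⟨hθ₀, hsum⟩
  | succ t ih =>
    have h := A.primalStep_spec hφ hσ hs ih.1 ih.2 (stepSize t)
      (A.stochGrad (A.iterates φ β θ₀ ω t).2 (ω t).2)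
    exact ⟨h.1, h.2.1⟩

theorem iterates_snd_mem (φ : EuclideanSpace ℝ (Fin d) → ℝ) (θ₀ : EuclideanSpace ℝ (Fin d))
    (β : ℝ) (ω : ℕ → Fin d × (Fin n × Fin m)) (t : ℕ) :
    (A.iterates φ β θ₀ ω t).2 ∈ multiplierSet n m (A.multiplierBound β) := by
  cases t with
  | zero => exact ⟨fun p => le_rfl, by simpa [iterates] using (A.multiplierBound_pos β).le⟩
  | succ t => exact A.dualStep_mem _ _ _

theorem dependsOn_iterates (φ : EuclideanSpace ℝ (Fin d) → ℝ) (β : ℝ)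
    (θ₀ : EuclideanSpace ℝ (Fin d)) (t : ℕ) :
    DependsOn (fun ω => A.iterates φ β θ₀ ω t) (Set.Iio t) := by
  induction t with
  | zero => exact fun x y _ => rfl
  | succ t ih =>
    intro x y hxy
    have h1 : A.iterates φ β θ₀ x t = A.iterates φ β θ₀ y t :=
      ih fun i hi => hxy i (Nat.lt_succ_of_lt hi)
    have h2 : x t = y t := hxy t (Nat.lt_succ_self t)
    simp only [iterates, h1, h2]

/-- The error of the stochastic gradient in round `t`, paired with `θ_t - u`, if the query
returns `q`. -/
noncomputable def gradNoise (φ : EuclideanSpace ℝ (Fin d) → ℝ) (β : ℝ)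
    (θ₀ u : EuclideanSpace ℝ (Fin d)) (t : ℕ) (ω : ℕ → Fin d × (Fin n × Fin m))
    (q : Fin d × (Fin n × Fin m)) : ℝ :=
  stepSize t * inner ℝ (A.lagrangianGrad (A.iterates φ β θ₀ ω t).2 -
    A.stochGrad (A.iterates φ β θ₀ ω t).2 q.2) ((A.iterates φ β θ₀ ω t).1 - u)

theorem dependsOn_gradNoise (φ : EuclideanSpace ℝ (Fin d) → ℝ) (β : ℝ)
    (θ₀ u : EuclideanSpace ℝ (Fin d)) (t : ℕ) :
    DependsOn (A.gradNoise φ β θ₀ u t) (Set.Iio t) := fun x y hxy => by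
  have h : A.iterates φ β θ₀ x t = A.iterates φ β θ₀ y t := A.dependsOn_iterates φ β θ₀ t hxy
  funext q
  simp only [gradNoise, h]

theorem mean_gradNoise [NeZero d] (φ : EuclideanSpace ℝ (Fin d) → ℝ) (β : ℝ)
    (θ₀ u : EuclideanSpace ℝ (Fin d)) (t : ℕ) (ω : ℕ → Fin d × (Fin n × Fin m)) :
    ∑ q, (A.queryLaw q).toReal * A.gradNoise φ β θ₀ u t ω q = 0 := by
  have hone : ∑ q, (A.queryLaw q).toReal = 1 := by
    have h := A.queryLaw.tsum_coe
    rw [tsum_fintype] at h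
    rw [← ENNReal.toReal_sum fun q _ => A.queryLaw.apply_ne_top q, h, ENNReal.toReal_one]
  set lam := (A.iterates φ β θ₀ ω t).2 with hlam
  set v := (A.iterates φ β θ₀ ω t).1 - u with hv
  have h : ∑ q, (A.queryLaw q).toReal * A.gradNoise φ β θ₀ u t ω q =
      stepSize t * inner ℝ (∑ q, (A.queryLaw q).toReal •
        (A.lagrangianGrad lam - A.stochGrad lam q.2)) v := by
    rw [sum_inner, Finset.mul_sum]
    refine Finset.sum_congr rfl fun q _ => ?_
    rw [real_inner_smul_left, gradNoise]
    ring
  rw [h]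
  simp_rw [smul_sub]
  rw [Finset.sum_sub_distrib, A.mean_stochGrad, ← Finset.sum_smul, hone, one_smul, sub_self,
    inner_zero_left, mul_zero]

/-- Uniform bounds for the quantities that enter the regret. -/
theorem exists_bounds [NeZero d] (G : ℝ) (u : EuclideanSpace ℝ (Fin d)) :
    ∃ K : ℝ, 0 ≤ K ∧ (∀ lam ∈ multiplierSet n m G, ∀ p, ‖A.stochGrad lam p‖ ≤ K) ∧
      (∀ lam ∈ multiplierSet n m G, ‖A.lagrangianGrad lam‖ ≤ K) ∧
      (∀ θ ∈ A.ball, ‖A.mixVec θ‖ ≤ K) ∧ ∀ θ ∈ A.ball, ‖θ - u‖ ≤ K := by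
  have hc1 : ∀ p, Continuous fun lam => A.stochGrad lam p := fun p => by
    unfold stochGrad
    fun_prop
  have hc2 : Continuous A.lagrangianGrad := by
    unfold lagrangianGrad
    fun_prop
  have hc3 : Continuous A.mixVec := by
    unfold mixVec mix Matrix.mulVec dotProduct
    fun_prop
  have hsub : multiplierSet n m G ⊆ Metric.closedBall 0 G := fun lam h =>
    mem_closedBall_zero_iff.2 h.2
  have hK := isCompact_closedBall (0 : EuclideanSpace ℝ (Fin n × Fin m)) G
  choose K₁ hK₁ using fun p => hK.exists_bound_of_continuousOn (hc1 p).continuousOn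
  obtain ⟨K₂, hK₂⟩ := hK.exists_bound_of_continuousOn hc2.continuousOn
  obtain ⟨K₃, hK₃⟩ := A.isCompact_ball.exists_bound_of_continuousOn hc3.continuousOn
  obtain ⟨K₄, hK₄⟩ := A.isCompact_ball.exists_bound_of_continuousOn
    (f := fun θ => θ - u) (by fun_prop)
  have hS : 0 ≤ ∑ p, |K₁ p| := Finset.sum_nonneg fun p _ => abs_nonneg _
  refine ⟨∑ p, |K₁ p| + |K₂| + |K₃| + |K₄|, by positivity, fun lam hl p => ?_, fun lam hl => ?_,
    fun θ hθ => ?_, fun θ hθ => ?_⟩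
  · have h1 := (hK₁ p lam (hsub hl)).trans (le_abs_self _)
    have h2 := Finset.single_le_sum (f := fun p => |K₁ p|) (fun p _ => abs_nonneg _)
      (Finset.mem_univ p)
    have := abs_nonneg K₂
    have := abs_nonneg K₃
    have := abs_nonneg K₄
    linarith
  · have h1 := (hK₂ lam (hsub hl)).trans (le_abs_self _)
    have := abs_nonneg K₃
    have := abs_nonneg K₄
    linarith
  · have h1 := (hK₃ θ hθ).trans (le_abs_self _)
    have := abs_nonneg K₂
    have := abs_nonneg K₄
    linarith
  · have h1 := (hK₄ θ hθ).trans (le_abs_self _)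
    have := abs_nonneg K₂
    have := abs_nonneg K₃
    linarith

theorem stepSize_pos (t : ℕ) : 0 < stepSize t := by
  unfold stepSize
  positivity

/-- The regret bound of the primal-dual algorithm along every sequence of queries. -/
theorem sum_lagrangian_gap_le [NeZero d] {φ : EuclideanSpace ℝ (Fin d) → ℝ} {σ : ℝ}
    (hφ : IsLegendre A.ball φ) (hσ : 0 < σ) (hs : StronglyConvexGradient A.ball φ σ)
    {θ₀ u : EuclideanSpace ℝ (Fin d)} (hθ₀ : θ₀ ∈ interior A.ball) (hsum : ∑ i, θ₀ i = 1)
    (hu : u ∈ A.section2) {β K : ℝ}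
    (hK₁ : ∀ lam ∈ multiplierSet n m (A.multiplierBound β), ∀ p, ‖A.stochGrad lam p‖ ≤ K)
    (hK₃ : ∀ θ ∈ A.ball, ‖A.mixVec θ‖ ≤ K)
    {l : EuclideanSpace ℝ (Fin n × Fin m)} (hl : l ∈ multiplierSet n m (A.multiplierBound β))
    (ω : ℕ → Fin d × (Fin n × Fin m)) (T : ℕ) :
    ∑ t ∈ Finset.range T, stepSize t * (A.lagrangian (A.iterates φ β θ₀ ω t).1 l -
        A.lagrangian u (A.iterates φ β θ₀ ω t).2) ≤
      bregman φ u θ₀ + A.multiplierBound β ^ 2 / 2 +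
        (K ^ 2 / (2 * σ) + K ^ 2 / 2) * ∑ t ∈ Finset.range T, stepSize t ^ 2 +
        ∑ t ∈ Finset.range T, A.gradNoise φ β θ₀ u t ω (ω t) := by
  have hmem := A.iterates_fst_mem hφ hσ hs hθ₀ hsum β ω
  have hlam := A.iterates_snd_mem φ θ₀ β ω
  -- The two potentials at time `T` are kept so that the induction telescopes; they are discarded
  -- afterwards by sign.
  have hmain : ∀ T : ℕ, ∑ t ∈ Finset.range T,
      stepSize t * (A.lagrangian (A.iterates φ β θ₀ ω t).1 l -
        A.lagrangian u (A.iterates φ β θ₀ ω t).2) ≤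
      (bregman φ u θ₀ - bregman φ u (A.iterates φ β θ₀ ω T).1) +
        (‖l‖ ^ 2 / 2 - ‖(A.iterates φ β θ₀ ω T).2 - l‖ ^ 2 / 2) +
        (K ^ 2 / (2 * σ) + K ^ 2 / 2) * ∑ t ∈ Finset.range T, stepSize t ^ 2 +
        ∑ t ∈ Finset.range T, A.gradNoise φ β θ₀ u t ω (ω t) := fun T => by
    induction T with
    | zero => simp [iterates]
    | succ T ih =>
      rw [Finset.sum_range_succ, Finset.sum_range_succ, Finset.sum_range_succ]
      set x := A.iterates φ β θ₀ ω T with hx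
      have hstep : A.iterates φ β θ₀ ω (T + 1) =
        (A.primalStep φ (stepSize T) x.1 (A.stochGrad x.2 (ω T).2),
          A.dualStep β (stepSize T) x.1 x.2) := rfl
      rw [hstep]
      have h1 := A.dualStep_regret (η := stepSize T) x.1 x.2 hl
      have h2 := A.primalStep_regret hφ hσ hs (hmem T).1 (hmem T).2 hu.1 (stepSize T)
        (A.stochGrad x.2 (ω T).2)
      have h3 : stepSize T ^ 2 * ‖A.mixVec x.1‖ ^ 2 / 2 ≤ K ^ 2 / 2 * stepSize T ^ 2 := by
        have := hK₃ x.1 (interior_subset (hmem T).1)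
        rw [div_mul_eq_mul_div, mul_comm]
        gcongr
      have h4 : stepSize T ^ 2 * ‖A.stochGrad x.2 (ω T).2‖ ^ 2 / (2 * σ) ≤
          K ^ 2 / (2 * σ) * stepSize T ^ 2 := by
        have := hK₁ x.2 (hlam T) (ω T).2
        rw [div_mul_eq_mul_div, mul_comm]
        gcongr
      have h5 : A.gradNoise φ β θ₀ u T ω (ω T) =
          stepSize T * (A.lagrangian x.1 x.2 - A.lagrangian u x.2) -
            stepSize T * inner ℝ (A.stochGrad x.2 (ω T).2) (x.1 - u) := by
        rw [gradNoise, ← hx, inner_sub_left, inner_sub_right, inner_lagrangianGrad,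
          inner_lagrangianGrad]
        ring
      rw [h5]
      linarith
  have h1 := hmain T
  have h2 : 0 ≤ bregman φ u (A.iterates φ β θ₀ ω T).1 := by
    have := hs _ (hmem T).1 u hu.2
    have h3 : 0 ≤ σ / 2 * ‖u - (A.iterates φ β θ₀ ω T).1‖ ^ 2 := by positivity
    rw [bregman]
    linarith
  have h3 : ‖l‖ ^ 2 ≤ A.multiplierBound β ^ 2 := pow_le_pow_left₀ (norm_nonneg l) hl.2 2
  have h4 := sq_nonneg ‖(A.iterates φ β θ₀ ω T).2 - l‖
  linarith

theorem inner_average_mul (φ : EuclideanSpace ℝ (Fin d) → ℝ) (β : ℝ)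
    (θ₀ : EuclideanSpace ℝ (Fin d)) {T : ℕ} (hT : 0 < T) (ω : ℕ → Fin d × (Fin n × Fin m))
    (v : EuclideanSpace ℝ (Fin d)) :
    (∑ t ∈ Finset.range T, stepSize t) * inner ℝ v (A.average φ β θ₀ T ω) =
      ∑ t ∈ Finset.range T, stepSize t * inner ℝ v (A.iterates φ β θ₀ ω t).1 := by
  have hS : 0 < ∑ t ∈ Finset.range T, stepSize t :=
    Finset.sum_pos (fun t _ => stepSize_pos t) (Finset.nonempty_range_iff.2 hT.ne')
  rw [average, real_inner_smul_right, mul_inv_cancel_left₀ hS.ne', inner_sum]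
  exact Finset.sum_congr rfl fun t _ => real_inner_smul_right _ _ _

end DualALP

/-! ### Discounted flow equations. -/

namespace MDP

variable {n m : ℕ} (M : MDP n m)

theorem stateMeasure_flow {π : Fin n → Fin m → ℝ} (hπ : π ∈ policies n m) (s' : Fin n) :
    M.stateMeasure π s' =
      (1 - M.γ) * M.α s' + M.γ * ∑ s, M.stateMeasure π s * M.trans π s s' := by
  have hstep : ∀ t : ℕ, M.γ ^ (t + 1) * (M.α ᵥ* (M.trans π ^ (t + 1))) s' =
      ∑ s, M.γ * M.trans π s s' * (M.γ ^ t * (M.α ᵥ* (M.trans π ^ t)) s) := fun t => by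
    rw [pow_succ (M.trans π), ← Matrix.vecMul_vecMul, Matrix.vecMul, dotProduct, Finset.mul_sum]
    exact Finset.sum_congr rfl fun s _ => by ring
  have hsum := M.summable_stateMeasure hπ
  simp only [stateMeasure]
  rw [(hsum s').tsum_eq_zero_add]
  simp_rw [hstep]
  rw [Summable.tsum_finsetSum fun s _ => (hsum s).mul_left _]
  simp_rw [tsum_mul_left]
  simp only [pow_zero, Matrix.vecMul_one, one_mul, mul_add, Finset.mul_sum]
  congr 1
  exact Finset.sum_congr rfl fun s _ => by ring

/-- Stability of the discounted flow equations in `ℓ¹`. -/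
theorem sum_abs_le_of_flow {π : Fin n → Fin m → ℝ} (hπ : π ∈ policies n m) {w e : Fin n → ℝ}
    (h : ∀ s', w s' = M.γ * ∑ s, w s * M.trans π s s' + e s') :
    (1 - M.γ) * ∑ s, |w s| ≤ ∑ s, |e s| := by
  have hP := (mem_rowStochastic_iff_sum.1 (M.trans_mem hπ))
  have h1 : ∑ s', |w s'| ≤ ∑ s', (M.γ * ∑ s, |w s| * M.trans π s s' + |e s'|) := by
    refine Finset.sum_le_sum fun s' _ => ?_
    conv_lhs => rw [h s']
    refine (abs_add_le _ _).trans (add_le_add_left ?_ _)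
    rw [abs_mul, abs_of_pos M.γ_pos]
    refine mul_le_mul_of_nonneg_left ((Finset.abs_sum_le_sum_abs _ _).trans_eq ?_) M.γ_pos.le
    exact Finset.sum_congr rfl fun s _ => by rw [abs_mul, abs_of_nonneg (hP.1 s s')]
  rw [Finset.sum_add_distrib, ← Finset.mul_sum, Finset.sum_comm] at h1
  simp_rw [← Finset.mul_sum, hP.2, mul_one] at h1
  linarith

end MDP

/-! ### From the duality gap to the cost of the output policy. -/

namespace DualALP

variable {n m d : ℕ} (A : DualALP n m d)

theorem mix_apply (θ : EuclideanSpace ℝ (Fin d)) (p : Fin n × Fin m) :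
    A.mix θ p = ∑ i, A.mdp.occ (A.base i) p * θ i := rfl

/-- Signed mixtures of occupation measures satisfy the discounted flow equations. -/
theorem mix_flow {θ : EuclideanSpace ℝ (Fin d)} (hθ : ∑ i, θ i = 1) (s' : Fin n) :
    ∑ a, A.mix θ (s', a) =
      (1 - A.mdp.γ) * A.mdp.α s' + A.mdp.γ * ∑ s, ∑ a, A.mix θ (s, a) * A.mdp.P s a s' := by
  have h1 : ∑ a, A.mix θ (s', a) = ∑ i, A.mdp.stateMeasure (A.base i) s' * θ i := by
    simp only [mix_apply]
    rw [Finset.sum_comm]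
    refine Finset.sum_congr rfl fun i _ => ?_
    simp only [MDP.occ]
    rw [← Finset.sum_mul, ← Finset.sum_mul, (A.base_mem i s').2, one_mul]
  have h2 : ∀ s, ∑ a, A.mix θ (s, a) * A.mdp.P s a s' =
      ∑ i, A.mdp.stateMeasure (A.base i) s * A.mdp.trans (A.base i) s s' * θ i := fun s => by
    simp only [mix_apply, MDP.occ, MDP.trans, Matrix.of_apply, Finset.sum_mul, Finset.mul_sum]
    rw [Finset.sum_comm]
    exact Finset.sum_congr rfl fun i _ => Finset.sum_congr rfl fun a _ => by ring
  rw [h1]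
  simp_rw [h2]
  rw [Finset.sum_comm]
  simp_rw [← Finset.sum_mul]
  calc ∑ i, A.mdp.stateMeasure (A.base i) s' * θ i
      = ∑ i, ((1 - A.mdp.γ) * A.mdp.α s' * θ i + A.mdp.γ * ((∑ s, A.mdp.stateMeasure (A.base i) s *
          A.mdp.trans (A.base i) s s') * θ i)) := Finset.sum_congr rfl fun i _ => by
        rw [A.mdp.stateMeasure_flow (A.base_mem i) s']; ring
    _ = _ := by
        rw [Finset.sum_add_distrib, ← Finset.mul_sum, ← Finset.mul_sum, hθ, mul_one]

theorem policyOf_mem [NeZero m] (θ : EuclideanSpace ℝ (Fin d)) :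
    A.policyOf θ ∈ policies n m := by
  have hm : (m : ℝ) ≠ 0 := Nat.cast_ne_zero.2 (NeZero.ne m)
  intro s
  constructor
  · intro a
    simp only [policyOf]
    split_ifs
    · positivity
    · exact div_nonneg (le_max_right _ _) (Finset.sum_nonneg fun a _ => le_max_right _ _)
  · simp only [policyOf]
    split_ifs with h
    · simp [hm]
    · rw [← Finset.sum_div, div_self h]

theorem policyOf_mul_sum (θ : EuclideanSpace ℝ (Fin d)) (s : Fin n) (a : Fin m) :
    A.policyOf θ s a * ∑ a', max (A.mix θ (s, a')) 0 = max (A.mix θ (s, a)) 0 := by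
  simp only [policyOf]
  split_ifs with h
  · rw [h, mul_zero]
    exact ((Finset.sum_eq_zero_iff_of_nonneg fun a _ => le_max_right _ _).1 h a
      (Finset.mem_univ a)).symm
  · exact div_mul_cancel₀ _ h

/-- The occupation measure of the policy of `θ` is close to `Ψ θ` if the negative part of `Ψ θ`
is small. -/
theorem sum_abs_occ_policyOf_sub_mix_le [NeZero m] {θ : EuclideanSpace ℝ (Fin d)}
    (hθ : ∑ i, θ i = 1) :
    ∑ p, |A.mdp.occ (A.policyOf θ) p - A.mix θ p| ≤
      (2 / (1 - A.mdp.γ) + 1) * ∑ p, max (-A.mix θ p) 0 := by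
  set γ := A.mdp.γ with hγdef
  have hγ : 0 < 1 - γ := sub_pos.2 A.mdp.γ_lt_one
  have hγ0 : 0 < γ := A.mdp.γ_pos
  have hγ1 : γ < 1 := A.mdp.γ_lt_one
  have hπ := A.policyOf_mem θ
  set π := A.policyOf θ with hπdef
  set neg : Fin n × Fin m → ℝ := fun p => max (-A.mix θ p) 0 with hneg
  have hneg0 : ∀ p, 0 ≤ neg p := fun p => le_max_right _ _
  have hpos : ∀ p, max (A.mix θ p) 0 = A.mix θ p + neg p := fun p => by
    simp only [hneg]
    rcases le_total (A.mix θ p) 0 with h | h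
    · rw [max_eq_right h, max_eq_left (neg_nonneg.2 h)]; ring
    · rw [max_eq_left h, max_eq_right (neg_nonpos.2 h)]; ring
  set v : Fin n → ℝ := fun s => ∑ a, max (A.mix θ (s, a)) 0 with hv
  have hπv : ∀ s a, π s a * v s = A.mix θ (s, a) + neg (s, a) := fun s a => by
    rw [← hpos]
    exact A.policyOf_mul_sum θ s a
  -- The defect of the positive part in the flow equations of `π`. The state measure of `π` solves
  -- them exactly, so `v` minus it solves the homogeneous system with source `e`.
  set e : Fin n → ℝ := fun s' =>
    ∑ a, neg (s', a) - γ * ∑ s, ∑ a, neg (s, a) * A.mdp.P s a s' with he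
  have hflow : ∀ s', v s' - A.mdp.stateMeasure π s' =
      γ * ∑ s, (v s - A.mdp.stateMeasure π s) * A.mdp.trans π s s' + e s' := fun s' => by
    have h1 : v s' = ∑ a, A.mix θ (s', a) + ∑ a, neg (s', a) := by
      simp only [hv, hpos, Finset.sum_add_distrib]
    have h2 : ∑ s, v s * A.mdp.trans π s s' =
        ∑ s, ∑ a, A.mix θ (s, a) * A.mdp.P s a s' + ∑ s, ∑ a, neg (s, a) * A.mdp.P s a s' := by
      rw [← Finset.sum_add_distrib]
      refine Finset.sum_congr rfl fun s _ => ?_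
      rw [← Finset.sum_add_distrib, MDP.trans, Matrix.of_apply, Finset.mul_sum]
      refine Finset.sum_congr rfl fun a _ => ?_
      rw [← add_mul, ← hπv]
      ring
    simp_rw [sub_mul]
    rw [Finset.sum_sub_distrib, h2, A.mdp.stateMeasure_flow hπ s', h1, A.mix_flow hθ s']
    simp only [he, ← hγdef]
    ring
  have hstab := A.mdp.sum_abs_le_of_flow hπ hflow
  rw [← hγdef] at hstab
  have hN0 : 0 ≤ ∑ p, neg p := Finset.sum_nonneg fun p _ => hneg0 p
  have hesum : ∑ s', |e s'| ≤ 2 * ∑ p, neg p := by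
    have h1 : ∀ s', |e s'| ≤ ∑ a, neg (s', a) + γ * ∑ s, ∑ a, neg (s, a) * A.mdp.P s a s' :=
      fun s' => by
        have h2 : 0 ≤ ∑ a, neg (s', a) := Finset.sum_nonneg fun a _ => hneg0 _
        have h3 : 0 ≤ γ * ∑ s, ∑ a, neg (s, a) * A.mdp.P s a s' :=
          mul_nonneg hγ0.le (Finset.sum_nonneg fun s _ => Finset.sum_nonneg fun a _ =>
            mul_nonneg (hneg0 _) ((A.mdp.P_mem s a).1 s'))
        rw [abs_le]
        constructor <;> simp only [he] <;> linarith
    have h4 : ∑ s', ∑ s, ∑ a, neg (s, a) * A.mdp.P s a s' = ∑ p, neg p := by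
      rw [Finset.sum_comm, Fintype.sum_prod_type]
      refine Finset.sum_congr rfl fun s _ => ?_
      rw [Finset.sum_comm]
      refine Finset.sum_congr rfl fun a _ => ?_
      rw [← Finset.mul_sum, (A.mdp.P_mem s a).2, mul_one]
    calc ∑ s', |e s'| ≤ ∑ s', (∑ a, neg (s', a) + γ * ∑ s, ∑ a, neg (s, a) * A.mdp.P s a s') :=
          Finset.sum_le_sum fun s' _ => h1 s'
      _ = ∑ p, neg p + γ * ∑ p, neg p := by
          rw [Finset.sum_add_distrib, ← Finset.mul_sum, h4, Fintype.sum_prod_type]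
      _ ≤ 2 * ∑ p, neg p := by nlinarith
  have hvμ : ∑ s, |v s - A.mdp.stateMeasure π s| ≤ 2 / (1 - γ) * ∑ p, neg p := by
    rw [div_mul_eq_mul_div, le_div_iff₀ hγ, mul_comm]
    exact hstab.trans hesum
  have hpt : ∀ s a, |A.mdp.occ π (s, a) - A.mix θ (s, a)| ≤
      π s a * |v s - A.mdp.stateMeasure π s| + neg (s, a) := fun s a => by
    have h1 : A.mdp.occ π (s, a) - A.mix θ (s, a) =
        -(π s a * (v s - A.mdp.stateMeasure π s)) + neg (s, a) := by
      have := hπv s a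
      simp only [MDP.occ]
      linarith
    rw [h1]
    refine (abs_add_le _ _).trans_eq ?_
    rw [abs_neg, abs_mul, abs_of_nonneg ((hπ s).1 a), abs_of_nonneg (hneg0 _)]
  calc ∑ p, |A.mdp.occ π p - A.mix θ p|
      ≤ ∑ s, ∑ a, (π s a * |v s - A.mdp.stateMeasure π s| + neg (s, a)) := by
        rw [Fintype.sum_prod_type]
        exact Finset.sum_le_sum fun s _ => Finset.sum_le_sum fun a _ => hpt s a
    _ = ∑ s, |v s - A.mdp.stateMeasure π s| + ∑ p, neg p := by
        simp_rw [Finset.sum_add_distrib, ← Finset.sum_mul, (hπ _).2, one_mul]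
        rw [Fintype.sum_prod_type]
    _ ≤ (2 / (1 - γ) + 1) * ∑ p, neg p := by linarith

/-- The negative part of `Ψ θ` as a Euclidean vector. -/
noncomputable def negPart (θ : EuclideanSpace ℝ (Fin d)) : EuclideanSpace ℝ (Fin n × Fin m) :=
  WithLp.toLp 2 fun p => max (-A.mix θ p) 0

theorem inner_mixVec_negPart (θ : EuclideanSpace ℝ (Fin d)) :
    inner ℝ (A.mixVec θ) (A.negPart θ) = -‖A.negPart θ‖ ^ 2 := by
  rw [EuclideanSpace.norm_sq_eq, PiLp.inner_apply, ← Finset.sum_neg_distrib]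
  refine Finset.sum_congr rfl fun p _ => ?_
  simp only [mixVec, negPart, RCLike.inner_apply, conj_trivial, Real.norm_eq_abs, sq_abs]
  rcases le_total (A.mix θ p) 0 with h | h
  · rw [max_eq_left (neg_nonneg.2 h)]; ring
  · rw [max_eq_right (neg_nonpos.2 h)]; ring

theorem neg_inner_mixVec_le {θ : EuclideanSpace ℝ (Fin d)}
    {lam : EuclideanSpace ℝ (Fin n × Fin m)} (hlam : ∀ p, 0 ≤ lam p) :
    -inner ℝ (A.mixVec θ) lam ≤ ‖lam‖ * ‖A.negPart θ‖ := by
  refine le_trans ?_ (real_inner_le_norm lam (A.negPart θ))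
  simp only [PiLp.inner_apply, ← Finset.sum_neg_distrib]
  refine Finset.sum_le_sum fun p _ => ?_
  simp only [mixVec, negPart, RCLike.inner_apply, conj_trivial]
  nlinarith [le_max_left (-A.mix θ p) 0, hlam p]

theorem exists_cost_policyOf_le [NeZero m] : ∃ K : ℝ, 0 ≤ K ∧
    ∀ θ : EuclideanSpace ℝ (Fin d), ∑ i, θ i = 1 →
      A.mdp.cost (A.mdp.occ (A.policyOf θ)) ≤ A.mdp.cost (A.mix θ) + K * ‖A.negPart θ‖ := by
  have hγ : 0 < 1 - A.mdp.γ := sub_pos.2 A.mdp.γ_lt_one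
  set c₀ := ∑ p : Fin n × Fin m, |A.mdp.c p.1 p.2| with hc₀
  have hc₀0 : 0 ≤ c₀ := Finset.sum_nonneg fun p _ => abs_nonneg _
  refine ⟨c₀ * ((2 / (1 - A.mdp.γ) + 1) * Fintype.card (Fin n × Fin m)), by positivity,
    fun θ hθ => ?_⟩
  have h1 := A.sum_abs_occ_policyOf_sub_mix_le hθ
  have h2 : ∑ p, max (-A.mix θ p) 0 ≤ Fintype.card (Fin n × Fin m) * ‖A.negPart θ‖ := by
    rw [← nsmul_eq_mul]
    refine Finset.sum_le_card_nsmul _ _ _ fun p _ => ?_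
    exact (le_abs_self _).trans (PiLp.norm_apply_le (A.negPart θ) p)
  have h3 : A.mdp.cost (A.mdp.occ (A.policyOf θ)) - A.mdp.cost (A.mix θ) ≤
      c₀ * ∑ p, |A.mdp.occ (A.policyOf θ) p - A.mix θ p| := by
    rw [MDP.cost, MDP.cost, ← Finset.sum_sub_distrib, Finset.mul_sum]
    refine Finset.sum_le_sum fun p _ => ?_
    rw [← mul_sub]
    refine (le_abs_self _).trans ?_
    rw [abs_mul]
    refine mul_le_mul_of_nonneg_right ?_ (abs_nonneg _)
    exact Finset.single_le_sum (f := fun p : Fin n × Fin m => |A.mdp.c p.1 p.2|)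
      (fun p _ => abs_nonneg _) (Finset.mem_univ p)
  have h4 : c₀ * ∑ p, |A.mdp.occ (A.policyOf θ) p - A.mix θ p| ≤
      c₀ * ((2 / (1 - A.mdp.γ) + 1) * (Fintype.card (Fin n × Fin m) * ‖A.negPart θ‖)) := by
    refine mul_le_mul_of_nonneg_left (h1.trans ?_) hc₀0
    exact mul_le_mul_of_nonneg_left h2 (by positivity)
  linarith

/-- The value of the Lagrangian at a saddle point is at least the cost of an optimal solution. -/
theorem IsSaddlePoint.cost_le {A : DualALP n m d} {θ θstar : EuclideanSpace ℝ (Fin d)}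
    {lam : EuclideanSpace ℝ (Fin n × Fin m)} (h : A.IsSaddlePoint θ lam)
    (hopt : A.IsOptimal θstar) : A.mdp.cost (A.mix θstar) ≤ A.lagrangian θ lam := by
  obtain ⟨hθ, hlam, hmax, -⟩ := h
  have hfeas : θ ∈ A.feasible := by
    refine ⟨hθ, fun p => ?_⟩
    -- Raising one multiplier cannot increase the Lagrangian, so that constraint holds at `θ`.
    have h1 := hmax (lam + EuclideanSpace.single p 1) fun q => by
      rw [PiLp.add_apply]
      refine add_nonneg (hlam q) ?_
      rw [PiLp.single_apply]
      split_ifs <;> norm_num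
    rw [lagrangian_eq_sub_inner, lagrangian_eq_sub_inner, inner_add_right,
      EuclideanSpace.inner_single_right] at h1
    simp only [conj_trivial, one_mul, mixVec] at h1
    linarith
  have h0 := hmax 0 fun p => le_rfl
  rw [lagrangian_eq_sub_inner, inner_zero_right, sub_zero] at h0
  exact (hopt.2 θ hfeas).trans h0

/-- A small duality gap makes the policy of `θ` nearly optimal. -/
theorem cost_policyOf_le_of_gap {θ : EuclideanSpace ℝ (Fin d)} {K G v gap : ℝ}
    {lam : EuclideanSpace ℝ (Fin n × Fin m)} (hK : 0 ≤ K)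
    (hcost : A.mdp.cost (A.mdp.occ (A.policyOf θ)) ≤ A.mdp.cost (A.mix θ) + K * ‖A.negPart θ‖)
    (hlam : ∀ p, 0 ≤ lam p) (hG : ‖lam‖ + 1 ≤ G) (hsaddle : v ≤ A.lagrangian θ lam)
    (hgap : ∀ l ∈ multiplierSet n m G, A.lagrangian θ l ≤ v + gap) :
    A.mdp.cost (A.mdp.occ (A.policyOf θ)) ≤ v + (1 + K) * gap := by
  have hG0 : 0 ≤ G := (by positivity : (0 : ℝ) ≤ ‖lam‖ + 1).trans hG
  have h0 := hgap 0 ⟨fun p => le_rfl, by simpa using hG0⟩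
  rw [lagrangian_eq_sub_inner, inner_zero_right, sub_zero] at h0
  rw [lagrangian_eq_sub_inner] at hsaddle
  have h1 := A.neg_inner_mixVec_le (θ := θ) hlam
  have h2 : A.mdp.cost (A.mix θ) + G * ‖A.negPart θ‖ ≤ v + gap := by
    rcases (norm_nonneg (A.negPart θ)).eq_or_lt' with h | h
    · rw [h, mul_zero, add_zero]; exact h0
    -- The worst multiplier of norm `G` points along the negative part and charges `G` times its
    -- norm.
    · have h3 := hgap ((G / ‖A.negPart θ‖) • A.negPart θ) ⟨fun p => ?_, ?_⟩
      · rw [lagrangian_eq_sub_inner, real_inner_smul_right, inner_mixVec_negPart] at h3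
        have h4 : G / ‖A.negPart θ‖ * -‖A.negPart θ‖ ^ 2 = -(G * ‖A.negPart θ‖) := by
          field_simp
        linarith
      · exact mul_nonneg (by positivity) (le_max_right _ _)
      · rw [norm_smul, Real.norm_of_nonneg (by positivity), div_mul_cancel₀ _ h.ne']
  -- The saddle inequality pays back at most `‖lam‖` times this norm, and `G` exceeds `‖lam‖` by at
  -- least one.
  have h3 : ‖A.negPart θ‖ ≤ gap := by
    have := mul_le_mul_of_nonneg_right hG (norm_nonneg (A.negPart θ))
    linarith
  have := mul_le_mul_of_nonneg_left h3 hK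
  linarith

end DualALP

/-! ### Step-size sums and positivity of the factors in the sample size. -/

theorem MDP.neZero_states {n m : ℕ} (M : MDP n m) : NeZero n := ⟨by
  rintro rfl
  simpa using M.α_mem.2⟩

namespace DualALP

theorem neZero_actions {n m d : ℕ} [NeZero d] (A : DualALP n m d) : NeZero m := ⟨by
  rintro rfl
  have := A.mdp.neZero_states
  simpa using (A.base_mem 0 0).2⟩

theorem stepSize_sq (t : ℕ) : stepSize t ^ 2 = ((t : ℝ) + 1)⁻¹ := by
  rw [stepSize, div_pow, Real.sq_sqrt (by positivity), one_pow, one_div]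

theorem sum_stepSize_sq_le (T : ℕ) :
    ∑ t ∈ Finset.range T, stepSize t ^ 2 ≤ 1 + Real.log T := by
  have h := harmonic_le_one_add_log T
  simpa [harmonic, stepSize_sq] using h

theorem one_le_sum_stepSize_sq {T : ℕ} (hT : 0 < T) :
    1 ≤ ∑ t ∈ Finset.range T, stepSize t ^ 2 := by
  have h := Finset.single_le_sum (f := fun t => stepSize t ^ 2) (fun t _ => sq_nonneg _)
    (Finset.mem_range.2 hT)
  simpa [stepSize] using h

theorem sqrt_le_sum_stepSize (T : ℕ) : √(T : ℝ) ≤ ∑ t ∈ Finset.range T, stepSize t := by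
  have h : (Finset.range T).card • (1 / √(T : ℝ)) ≤ ∑ t ∈ Finset.range T, stepSize t := by
    refine Finset.card_nsmul_le_sum _ _ _ fun t ht => ?_
    have ht' : (t : ℝ) + 1 ≤ T := by exact_mod_cast Finset.mem_range.1 ht
    exact one_div_le_one_div_of_le (Real.sqrt_pos.2 (by positivity)) (Real.sqrt_le_sqrt ht')
  rwa [Finset.card_range, nsmul_eq_mul, mul_one_div, Real.div_sqrt] at h

/-- Logarithmic terms are negligible at the sample size `κ / ε ^ 4`. -/
theorem exists_logarithmic_le_mul_sqrt {κ : ℝ} (hκ : 0 < κ) (a : ℝ) {b : ℝ} (hb : 0 ≤ b) :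
    ∃ ε₀ : ℝ, 0 < ε₀ ∧ ∀ ε : ℝ, 0 < ε → ε < ε₀ → ∀ T : ℕ, κ / ε ^ 4 ≤ T → 0 < T ∧
      a + b * ∑ t ∈ Finset.range T, stepSize t ^ 2 ≤ ε * √(T : ℝ) := by
  -- The sample size gives `κ^(1/4) ≤ ε T^(1/4)`, so it suffices that the logarithm is eventually at
  -- most `κ^(1/4) T^(1/4)`; two factors `T^(1/4)` make `√T`.
  have hlim : Tendsto (fun x : ℝ => (a + b * (1 + Real.log x)) / x ^ (1 / 4 : ℝ)) atTop (𝓝 0) := by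
    have h1 : Tendsto (fun x : ℝ => Real.log x / x ^ (1 / 4 : ℝ)) atTop (𝓝 0) :=
      (isLittleO_log_rpow_atTop (by norm_num)).tendsto_div_nhds_zero
    have h2 : Tendsto (fun x : ℝ => (x ^ (1 / 4 : ℝ))⁻¹) atTop (𝓝 0) :=
      (tendsto_rpow_atTop (by norm_num)).inv_tendsto_atTop
    have h3 := (h2.const_mul (a + b)).add (h1.const_mul b)
    simp only [mul_zero, add_zero] at h3
    refine h3.congr fun x => ?_
    rw [div_eq_mul_inv, div_eq_mul_inv]
    ring
  have hκ' : 0 < κ ^ (1 / 4 : ℝ) := Real.rpow_pos_of_pos hκ _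
  obtain ⟨x₀, hx₀⟩ := eventually_atTop.1 (hlim.eventually (eventually_le_nhds hκ'))
  set x₁ := max x₀ 1 with hx₁
  have hx₁0 : 0 < x₁ := lt_max_of_lt_right one_pos
  refine ⟨(κ / x₁) ^ (1 / 4 : ℝ), by positivity, fun ε hε hεlt T hT => ?_⟩
  have hε4 : ε ^ 4 < κ / x₁ := by
    have h := pow_lt_pow_left₀ hεlt hε.le (n := 4) (by norm_num)
    rwa [← Real.rpow_natCast ((κ / x₁) ^ (1 / 4 : ℝ)), ← Real.rpow_mul (by positivity),
      show (1 / 4 : ℝ) * (4 : ℕ) = 1 by norm_num, Real.rpow_one] at h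
  have hTx : x₁ ≤ T := by
    refine le_trans ?_ hT
    rw [le_div_iff₀ (by positivity)]
    have := (lt_div_iff₀ hx₁0).1 hε4
    linarith
  have hT0 : (0 : ℝ) < T := hx₁0.trans_le hTx
  refine ⟨by exact_mod_cast hT0, ?_⟩
  have h1 := hx₀ T ((le_max_left _ _).trans hTx)
  rw [div_le_iff₀ (by positivity)] at h1
  have h2 : κ ^ (1 / 4 : ℝ) ≤ ε * (T : ℝ) ^ (1 / 4 : ℝ) := by
    have h3 : κ ≤ ε ^ 4 * T := by
      rw [div_le_iff₀ (by positivity)] at hT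
      linarith
    have h4 := Real.rpow_le_rpow hκ.le h3 (by norm_num : (0 : ℝ) ≤ 1 / 4)
    rwa [Real.mul_rpow (by positivity) hT0.le, ← Real.rpow_natCast ε, ← Real.rpow_mul hε.le,
      show ((4 : ℕ) : ℝ) * (1 / 4) = 1 by norm_num, Real.rpow_one] at h4
  have h5 : (T : ℝ) ^ (1 / 4 : ℝ) * (T : ℝ) ^ (1 / 4 : ℝ) = √(T : ℝ) := by
    rw [← Real.rpow_add hT0, Real.sqrt_eq_rpow]
    norm_num
  calc a + b * ∑ t ∈ Finset.range T, stepSize t ^ 2 ≤ a + b * (1 + Real.log T) := by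
        gcongr
        exact sum_stepSize_sq_le T
    _ ≤ κ ^ (1 / 4 : ℝ) * (T : ℝ) ^ (1 / 4 : ℝ) := h1
    _ ≤ ε * (T : ℝ) ^ (1 / 4 : ℝ) * (T : ℝ) ^ (1 / 4 : ℝ) := by gcongr
    _ = ε * √(T : ℝ) := by rw [mul_assoc, h5]

variable {n m d : ℕ} (A : DualALP n m d)

/-- Fast mixing excludes the default value `0` of an unbounded supremum or an empty infimum in `ℕ`.
-/
theorem mixingTime_pos [NeZero d] {δ : ℝ} (hmix : A.mdp.FastMixing δ) :
    0 < A.mdp.mixingTime δ := by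
  obtain ⟨τ, hτ⟩ := hmix
  have hbdd : BddAbove (Set.range fun π : policies n m =>
      sInf {t : ℕ | 1 ≤ t ∧ A.mdp.MixedAt δ π t}) := by
    refine ⟨τ, ?_⟩
    rintro _ ⟨π, rfl⟩
    obtain ⟨t, h1, h2, h3⟩ := hτ π π.2
    have hmem : t ∈ {t : ℕ | 1 ≤ t ∧ A.mdp.MixedAt δ π t} := ⟨h1, h3⟩
    exact (Nat.sInf_le hmem).trans h2
  obtain ⟨t, h1, -, h3⟩ := hτ (A.base 0) (A.base_mem 0)
  have hne : {t : ℕ | 1 ≤ t ∧ A.mdp.MixedAt δ (A.base 0) t}.Nonempty := ⟨t, h1, h3⟩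
  exact lt_of_lt_of_le (Nat.sInf_mem hne).1 (le_ciSup hbdd (⟨A.base 0, A.base_mem 0⟩ : policies n m))

theorem exists_dualNrm_bound : ∃ c : ℝ, 0 < c ∧ ∀ z x, A.nrm x ≤ 1 → inner ℝ z x ≤ ‖z‖ / c := by
  obtain ⟨c, hc, h⟩ := exists_pos_mul_norm_le_seminorm A.nrm A.nrm_definite
  refine ⟨c, hc, fun z x hx => (real_inner_le_norm z x).trans ?_⟩
  rw [le_div_iff₀ hc, mul_assoc, mul_comm ‖x‖]
  exact mul_le_of_le_one_right (norm_nonneg z) ((h x).trans hx)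

theorem dualNrm_pos {z : EuclideanSpace ℝ (Fin d)} (hz : z ≠ 0) : 0 < A.dualNrm z := by
  obtain ⟨c, -, hb⟩ := A.exists_dualNrm_bound
  have hn : 0 < A.nrm z := lt_of_le_of_ne (apply_nonneg _ _) fun h => hz (A.nrm_definite z h.symm)
  have hbdd : BddAbove ((fun x => inner ℝ z x) '' {x | A.nrm x ≤ 1}) := by
    refine ⟨‖z‖ / c, ?_⟩
    rintro _ ⟨x, hx, rfl⟩
    exact hb z x hx
  have hmem : A.nrm ((A.nrm z)⁻¹ • z) ≤ 1 := by
    rw [map_smul_eq_mul, Real.norm_of_nonneg (by positivity), inv_mul_cancel₀ hn.ne']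
  refine lt_of_lt_of_le ?_ (le_csSup hbdd ⟨_, hmem, rfl⟩)
  have : 0 < ‖z‖ := norm_pos_iff.2 hz
  simp only [real_inner_smul_right, real_inner_self_eq_norm_sq]
  positivity

/-- The columns of `Ψ` are probability vectors, so the all-ones vector is mapped to the all-ones
vector. Boundedness is also needed, as an unbounded real supremum is `0`. -/
theorem subordNorm_pos [NeZero d] : 0 < A.subordNorm := by
  have := A.mdp.neZero_states
  have := A.neZero_actions
  obtain ⟨c, hc, hb⟩ := A.exists_dualNrm_bound
  have hdual : ∀ z, A.dualNrm z ≤ ‖z‖ / c := fun z => by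
    refine csSup_le ⟨_, 0, by simp, rfl⟩ ?_
    rintro _ ⟨x, hx, rfl⟩
    exact hb z x hx
  let f : EuclideanSpace ℝ (Fin n × Fin m) →ₗ[ℝ] EuclideanSpace ℝ (Fin d) :=
    { toFun := fun x => WithLp.toLp 2 (x.ofLp ᵥ* A.feat)
      map_add' := fun x y => by simp [Matrix.add_vecMul]
      map_smul' := fun r x => by simp [Matrix.smul_vecMul] }
  have hbdd : BddAbove ((fun x : EuclideanSpace ℝ (Fin n × Fin m) =>
      A.dualNrm (WithLp.toLp 2 (x.ofLp ᵥ* A.feat)) / ‖x‖) '' {x | x ≠ 0}) := by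
    refine ⟨‖LinearMap.toContinuousLinearMap f‖ / c, ?_⟩
    rintro _ ⟨x, hx, rfl⟩
    have h1 : ‖f x‖ ≤ _ := (LinearMap.toContinuousLinearMap f).le_opNorm x
    simp only
    rw [div_le_iff₀ (norm_pos_iff.2 hx), div_mul_eq_mul_div]
    exact (hdual (f x)).trans (by gcongr)
  have hones : ((fun _ => 1 : Fin n × Fin m → ℝ) ᵥ* A.feat) = fun _ => 1 := by
    funext j
    simp only [Matrix.vecMul, dotProduct, one_mul, feat, Matrix.of_apply]
    exact A.mdp.occ_sum (A.base_mem j)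
  have hx : (WithLp.toLp 2 fun _ => 1 : EuclideanSpace ℝ (Fin n × Fin m)) ≠ 0 := fun h => by
    simpa using congrArg (fun v : EuclideanSpace ℝ (Fin n × Fin m) => v (0, 0)) h
  have hz : onesVec d ≠ 0 := fun h => by
    simpa [onesVec] using congrArg (fun v : EuclideanSpace ℝ (Fin d) => v 0) h
  refine lt_of_lt_of_le ?_ (le_csSup hbdd ⟨_, hx, rfl⟩)
  simp only [hones]
  exact div_pos (A.dualNrm_pos hz) (norm_pos_iff.2 hx)

/-! ### Suboptimality of the averaged iterate. -/

theorem sum_average [NeZero d] {φ : EuclideanSpace ℝ (Fin d) → ℝ} {β : ℝ}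
    {θ₀ : EuclideanSpace ℝ (Fin d)} {T : ℕ} (hT : 0 < T) {ω : ℕ → Fin d × (Fin n × Fin m)}
    (h : ∀ t, ∑ i, (A.iterates φ β θ₀ ω t).1 i = 1) : ∑ i, A.average φ β θ₀ T ω i = 1 := by
  have hS : 0 < ∑ t ∈ Finset.range T, stepSize t :=
    Finset.sum_pos (fun t _ => stepSize_pos t) (Finset.nonempty_range_iff.2 hT.ne')
  have h1 := A.inner_average_mul φ β θ₀ hT ω (onesVec d)
  simp_rw [real_inner_comm _ (onesVec d), inner_onesVec, h, mul_one] at h1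
  exact (mul_eq_left₀ hS.ne').1 h1

/-- The suboptimality of the output policy is controlled by the gradient noise. -/
theorem exists_cost_le_of_noise_lt [NeZero d] {φ : EuclideanSpace ℝ (Fin d) → ℝ} {σ : ℝ}
    (hφ : IsLegendre A.ball φ) (hσ : 0 < σ) (hs : StronglyConvexGradient A.ball φ σ)
    {θ₀ θstar : EuclideanSpace ℝ (Fin d)} (hθ₀ : θ₀ ∈ interior A.ball) (hsum : ∑ i, θ₀ i = 1)
    (hopt : A.IsOptimal θstar) {θs : EuclideanSpace ℝ (Fin d)}
    {lam : EuclideanSpace ℝ (Fin n × Fin m)} (hsaddle : A.IsSaddlePoint θs lam) {β : ℝ}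
    (hβ : ‖lam‖ + 1 ≤ β) :
    ∃ a b k : ℝ, 0 ≤ b ∧ 0 ≤ k ∧ ∀ (T : ℕ) (ω : ℕ → Fin d × (Fin n × Fin m)) (s : ℝ), 0 < T →
      ∑ t ∈ Finset.range T, A.gradNoise φ β θ₀ θstar t ω (ω t) < s →
      A.mdp.cost (A.mdp.occ (A.policyOf (A.average φ β θ₀ T ω))) ≤ A.mdp.cost (A.mix θstar) +
        k * ((a + b * ∑ t ∈ Finset.range T, stepSize t ^ 2 + s) /
          ∑ t ∈ Finset.range T, stepSize t) := by
  have := A.neZero_actions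
  obtain ⟨K, hK0, hK₁, -, hK₃, -⟩ := A.exists_bounds (A.multiplierBound β) θstar
  obtain ⟨k, hk, hcost⟩ := A.exists_cost_policyOf_le
  refine ⟨bregman φ θstar θ₀ + A.multiplierBound β ^ 2 / 2, K ^ 2 / (2 * σ) + K ^ 2 / 2, 1 + k,
    by positivity, by positivity, fun T ω s hT hnoise => ?_⟩
  set S := ∑ t ∈ Finset.range T, stepSize t with hSdef
  have hS : 0 < S :=
    Finset.sum_pos (fun t _ => stepSize_pos t) (Finset.nonempty_range_iff.2 hT.ne')
  have hmem := A.iterates_fst_mem hφ hσ hs hθ₀ hsum β ω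
  have havg : ∀ l, S * A.lagrangian (A.average φ β θ₀ T ω) l =
      ∑ t ∈ Finset.range T, stepSize t * A.lagrangian (A.iterates φ β θ₀ ω t).1 l := fun l => by
    simp_rw [← inner_lagrangianGrad]
    exact A.inner_average_mul φ β θ₀ hT ω _
  refine A.cost_policyOf_le_of_gap (G := A.multiplierBound β) hk (hcost _ (A.sum_average hT fun t => (hmem t).2))
    hsaddle.2.1 (hβ.trans (le_max_right _ _)) ?_ fun l hl => ?_
  · refine le_of_mul_le_mul_left ?_ hS
    rw [havg, hSdef, Finset.sum_mul]
    refine Finset.sum_le_sum fun t _ => mul_le_mul_of_nonneg_left ?_ (stepSize_pos t).le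
    exact (hsaddle.cost_le hopt).trans
      (hsaddle.2.2.2 _ ⟨(hmem t).2, interior_subset (hmem t).1⟩)
  · have h1 := A.sum_lagrangian_gap_le hφ hσ hs hθ₀ hsum hopt.1.1 hK₁ hK₃ hl ω T
    -- The Lagrangian is linear in `θ`, and at the feasible point `θstar` it never exceeds the cost
    -- for a nonnegative multiplier.
    have h2 : S * A.lagrangian (A.average φ β θ₀ T ω) l - S * A.mdp.cost (A.mix θstar) ≤
        ∑ t ∈ Finset.range T, stepSize t * (A.lagrangian (A.iterates φ β θ₀ ω t).1 l -
          A.lagrangian θstar (A.iterates φ β θ₀ ω t).2) := by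
      rw [havg, hSdef, Finset.sum_mul, ← Finset.sum_sub_distrib]
      refine Finset.sum_le_sum fun t _ => ?_
      rw [← mul_sub]
      refine mul_le_mul_of_nonneg_left (sub_le_sub_left ?_ _) (stepSize_pos t).le
      refine sub_le_self _ (Finset.sum_nonneg fun p _ => mul_nonneg ?_ (hopt.1.2 p))
      exact (A.iterates_snd_mem φ θ₀ β ω t).1 p
    rw [← sub_le_iff_le_add', le_div_iff₀ hS]
    linarith

theorem exists_abs_gradNoise_le [NeZero d] {φ : EuclideanSpace ℝ (Fin d) → ℝ} {σ : ℝ}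
    (hφ : IsLegendre A.ball φ) (hσ : 0 < σ) (hs : StronglyConvexGradient A.ball φ σ)
    {θ₀ : EuclideanSpace ℝ (Fin d)} (hθ₀ : θ₀ ∈ interior A.ball) (hsum : ∑ i, θ₀ i = 1)
    (u : EuclideanSpace ℝ (Fin d)) (β : ℝ) :
    ∃ B : ℝ, 0 ≤ B ∧ ∀ t ω q, |A.gradNoise φ β θ₀ u t ω q| ≤ stepSize t * B := by
  obtain ⟨K, hK0, hK₁, hK₂, -, hK₄⟩ := A.exists_bounds (A.multiplierBound β) u
  refine ⟨(K + K) * K, by positivity, fun t ω q => ?_⟩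
  have hlam := A.iterates_snd_mem φ θ₀ β ω t
  rw [gradNoise, abs_mul, abs_of_pos (stepSize_pos t)]
  refine mul_le_mul_of_nonneg_left ((abs_real_inner_le_norm _ _).trans ?_) (stepSize_pos t).le
  refine mul_le_mul ((norm_sub_le _ _).trans (add_le_add (hK₂ _ hlam) (hK₁ _ hlam _)))
    (hK₄ _ (interior_subset (A.iterates_fst_mem hφ hσ hs hθ₀ hsum β ω t).1)) (norm_nonneg _)
    (by positivity)

end DualALP

theorem exists_stronglyConvexGradient {d : ℕ} {p : Seminorm ℝ (EuclideanSpace ℝ (Fin d))}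
    (hp : ∀ x, p x = 0 → x = 0) {C : Set (EuclideanSpace ℝ (Fin d))}
    {φ : EuclideanSpace ℝ (Fin d) → ℝ} {σ : ℝ} (hσ : 0 < σ)
    (h : ∀ x ∈ interior C, ∀ y ∈ C,
      φ x + inner ℝ (gradient φ x) (y - x) + σ / 2 * p (y - x) ^ 2 ≤ φ y) :
    ∃ σ' : ℝ, 0 < σ' ∧ StronglyConvexGradient C φ σ' := by
  obtain ⟨c, hc, hcp⟩ := exists_pos_mul_norm_le_seminorm p hp
  refine ⟨σ * c ^ 2, by positivity, fun x hx y hy => le_trans ?_ (h x hx y hy)⟩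
  have h1 : (c * ‖y - x‖) ^ 2 ≤ p (y - x) ^ 2 := pow_le_pow_left₀ (by positivity) (hcp _) 2
  have h2 := mul_le_mul_of_nonneg_left h1 (by positivity : 0 ≤ σ / 2)
  linarith

end MixtureMDP

theorem mainTheorem1 {n m d : ℕ} [NeZero d] (A : MixtureMDP.DualALP n m d)
    -- the Bregman modulus: a Legendre function with domain `Θ_R`, strongly convex for the norm
    (φ : EuclideanSpace ℝ (Fin d) → ℝ) (hφ : MixtureMDP.IsLegendre A.ball φ)
    (σ : ℝ) (hσ : 0 < σ)
    (hstrong : ∀ x ∈ interior A.ball, ∀ y ∈ A.ball,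
      φ x + inner ℝ (gradient φ x) (y - x) + σ / 2 * A.nrm (y - x) ^ 2 ≤ φ y)
    -- the initial point
    (θ₀ : EuclideanSpace ℝ (Fin d)) (hθ₀ : ∑ i, θ₀ i = 1) (hθ₀' : θ₀ ∈ interior A.ball)
    -- fast mixing and uniformly bounded ergodicity
    (δ : ℝ) (hδ : 0 < δ) (hδ' : δ < 1) (hmix : A.mdp.FastMixing δ)
    (herg : A.mdp.UniformlyErgodic)
    -- the optimal solution of the dual ALP, whose min-max problem has a saddle point
    (θstar : EuclideanSpace ℝ (Fin d)) (hopt : A.IsOptimal θstar)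
    (hsaddle : ∃ θ lam, A.IsSaddlePoint θ lam) :
    ∃ β₀ : ℝ, 0 < β₀ ∧ ∀ β : ℝ, β₀ ≤ β → ∀ C : ℝ, 0 < C → ∀ ρ : ℝ, 0 < ρ → ρ < 1 →
      ∃ ε₀ : ℝ, 0 < ε₀ ∧ ∀ ε : ℝ, 0 < ε → ε < ε₀ → ∀ T : ℕ,
        C * ((A.mdp.mixingTime δ : ℝ) ^ 4 * (n * m) * A.subordNorm ^ 4 /
          ((1 - A.mdp.γ) ^ 4 * ε ^ 4)) ≤ T →
        1 - ρ ≤ A.queryMeasure.real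
          {ω | A.mdp.cost (A.mdp.occ (A.policyOf (A.average φ β θ₀ T ω))) ≤
            A.mdp.cost (A.mix θstar) + ε} := by
  have := A.mdp.neZero_states
  have := A.neZero_actions
  obtain ⟨θs, lam, hsaddle⟩ := hsaddle
  obtain ⟨σ', hσ', hs⟩ := MixtureMDP.exists_stronglyConvexGradient A.nrm_definite hσ hstrong
  refine ⟨‖lam‖ + 1, by positivity, fun β hβ C hC ρ hρ hρ1 => ?_⟩
  obtain ⟨a, b, k, hb, hk, hcost⟩ :=
    A.exists_cost_le_of_noise_lt hφ hσ' hs hθ₀' hθ₀ hopt hsaddle hβ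
  obtain ⟨B, hB, hnoise⟩ := A.exists_abs_gradNoise_le hφ hσ' hs hθ₀' hθ₀ θstar β
  have hγ : 0 < 1 - A.mdp.γ := sub_pos.2 A.mdp.γ_lt_one
  have hτ : (0 : ℝ) < A.mdp.mixingTime δ := Nat.cast_pos.2 (A.mixingTime_pos hmix)
  have hn : (0 : ℝ) < n := Nat.cast_pos.2 (NeZero.pos n)
  have hm : (0 : ℝ) < m := Nat.cast_pos.2 (NeZero.pos m)
  have hΨ := A.subordNorm_pos
  have hκ : 0 < C * ((A.mdp.mixingTime δ : ℝ) ^ 4 * (n * m) * A.subordNorm ^ 4 /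
      (1 - A.mdp.γ) ^ 4) := by positivity
  obtain ⟨ε₀, hε₀, hsmall⟩ := MixtureMDP.DualALP.exists_logarithmic_le_mul_sqrt hκ (k * a)
    (b := k * (b + (B ^ 2 + 1) / ρ)) (by positivity)
  refine ⟨ε₀, hε₀, fun ε hε hεlt T hT => ?_⟩
  obtain ⟨hT0, hlog⟩ := hsmall ε hε hεlt T (by rwa [mul_div_assoc, div_div])
  set H := ∑ t ∈ Finset.range T, MixtureMDP.DualALP.stepSize t ^ 2 with hH
  have hH1 : 1 ≤ H := MixtureMDP.DualALP.one_le_sum_stepSize_sq hT0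
  -- The threshold is a multiple of `H`, so that it merges with the regret term. Chebyshev needs
  -- `B²H ≤ ρs²`, which follows from `H ≥ 1` and `ρ < 1`.
  have hprob := MixtureMDP.one_sub_le_measureReal_sum_martingaleDifference_lt A.queryLaw
    (A.dependsOn_gradNoise φ β θ₀ θstar) (A.mean_gradNoise φ β θ₀ θstar) hnoise T (ρ := ρ)
    (s := (B ^ 2 + 1) / ρ * H) (by positivity) (by
      simp_rw [mul_pow]
      rw [← Finset.sum_mul, ← hH]
      have h1 : ρ * ((B ^ 2 + 1) ^ 2 / ρ ^ 2 * H ^ 2) = (B ^ 2 + 1) ^ 2 * H ^ 2 / ρ := by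
        field_simp
      rw [div_pow, h1, le_div_iff₀ hρ]
      have h2 : B ^ 2 ≤ (B ^ 2 + 1) ^ 2 := by nlinarith [sq_nonneg B]
      have h3 : H ≤ H ^ 2 := by nlinarith
      calc H * B ^ 2 * ρ ≤ H * B ^ 2 * 1 := by gcongr
        _ ≤ (B ^ 2 + 1) ^ 2 * H ^ 2 := by
          rw [mul_one, mul_comm]
          gcongr)
  refine hprob.trans (measureReal_mono (fun ω hω => ?_) (measure_ne_top _ _))
  refine (hcost T ω _ hT0 hω).trans (add_le_add_right ?_ _)
  have hS := MixtureMDP.DualALP.sqrt_le_sum_stepSize T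
  have hS0 : 0 < √(T : ℝ) := Real.sqrt_pos.2 (Nat.cast_pos.2 hT0)
  rw [← mul_div_assoc, div_le_iff₀ (hS0.trans_le hS)]
  calc k * (a + b * H + (B ^ 2 + 1) / ρ * H)
      = k * a + k * (b + (B ^ 2 + 1) / ρ) * H := by ring
    _ ≤ ε * √(T : ℝ) := hlog
    _ ≤ _ := by gcongr
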